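/- Let $K$ be a local field of positive characteristic $p$: a non-discrete locally compact field with an ultrametric absolute value $|\cdot|$. Let $\mathcal O=\{|x|\le 1\}$, $\mathfrak P=\{|x|<1\}$, let $\mathfrak p$ be a prime element (an element of $\mathfrak P$ of maximal absolute value, so $\mathfrak P=\mathfrak p\mathcal O$), let $q=p^c$ be the number of elements of $\mathcal O/\mathfrak P$, and let $dx$ be the Haar measure of $K^+$ with $|\mathcal O|=1$. Fix units $1=\epsilon_0,\epsilon_1,\dots,\epsilon_{c-1}$ of $\mathcal O$ whose residues form a $GF(p)$-basis of $\mathcal O/\mathfrak P$. For $0\le n<q$ with $n=\sum_{i<c}a_ip^i$, $0\le a_i<p$, put $u(n)=\big(\sum_{i<c} a_i\epsilon_i\big)\mathfrak p^{-1}$; for $n=\sum_k b_kq^k$ with $0\le b_k<q$ put $u(n)=\sum_k u(b_k)\mathfrak p^{-k}$. A function $f$ on $K$ is integral periodic if $f(x+u(l))=f(x)$ for all $l\in\mathbb N_0$, $x\in K$. Let $\chi$ be a (continuous, unitary) character of $K^+$ that is trivial on $\mathcal O$, nontrivial on $\mathfrak p^{-1}\mathcal O$, and normalized by $\chi(\epsilon_\mu\epsilon_\nu\mathfrak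 p^{-j})=1$ for all $0\le\mu,\nu<c$ and $j\ge 2$. Let $\hat f(\xi)=\int_K f(x)\chi(-\xi x)\,dx$ be the corresponding Fourier transform, extended to $L^2(K)$ as the $L^2$-limit of the integrals over $\{|x|\le n\}$, $n\to\infty$. On $L^2(K)$ put $T_kf(x)=f(x-u(k))$ for $k\in\mathbb N_0$ and $D^jf(x)=q^{j/2}f(\mathfrak p^{-j}x)$ for $j\in\mathbb Z$. A sequence of vectors $(e_k)$ of a closed subspace $V$ is a Parseval frame for $V$ if $\sum_k|\langle f,e_k\rangle|^2=\|f\|^2$ for all $f\in V$. A function $\varphi\in L^2(K)$ is a Parseval scaling function associated with a Parseval multiresolution analysis if there is a closed subspace $V$ of $L^2(K)$ with $\varphi\in V$ such that $T_kV=V$ for all $k\in\mathbb N_0$, $V\subset D^1V$, $\bigcap_{j\in\mathbb Z}D^jV=\{0\}$, $\overline{\bigcup_{j\in\mathbb Z}D^jV}=L^2(K)$, and $\{T_k\varphi\}_{k\in\mathbb N_0}$ is a Parseval frame for $V$. **Proposition.** Let $\varphi\in L^2(K)$. Then $\varphi$ is a Parseval scaling function associated with a Parseval multiresolution analysis if and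 only if the following three conditions hold: (i) $\{\varphi(\cdot-u(k))\}_{k\in\mathbb N_0}$ is a Parseval frame for $\overline{\operatorname{span}}\{\varphi(\cdot-u(k)):k\in\mathbb N_0\}$; (ii) $\lim_{j\to\infty}|\hat\varphi(\mathfrak p^j\xi)|=1$ for a.e. $\xi\in K$; (iii) there is an integral periodic function $m_0$, square integrable on $\mathcal O$, such that $\hat\varphi(\xi)=m_0(\mathfrak p\xi)\,\hat\varphi(\mathfrak p\xi)$ for a.e. $\xi\in K$. -/

import Mathlib

open MeasureTheory Filter Topology
open scoped ENNReal

namespace LocalFieldMRA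

noncomputable section

/-! ### Arithmetic data of the local field

`K` is a nondiscrete locally compact field with an ultrametric absolute value `‖·‖`, of
characteristic `p`. Its ring of integers `𝒪` is the closed unit ball, its prime ideal `𝔓` the
open unit ball. -/

/-- `ϖ` is a prime element: an element of `𝔓` of maximal absolute value. -/
structure IsPrimeElement {K : Type*} [NontriviallyNormedField K] (ϖ : K) : Prop where
  norm_lt_one : ‖ϖ‖ < 1
  norm_le : ∀ x : K, ‖x‖ < 1 → ‖x‖ ≤ ‖ϖ‖

theorem IsPrimeElement.ne_zero {K : Type*} [NontriviallyNormedField K] {ϖ : K}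
    (h : IsPrimeElement ϖ) : ϖ ≠ 0 := by
  obtain ⟨x, hx0, hx1⟩ := NormedField.exists_norm_lt_one K
  exact norm_pos_iff.mp (hx0.trans_le (h.norm_le x hx1))

/-- `ε 0 = 1, ε 1, …, ε (c-1)` are units of `𝒪` whose residues modulo `𝔓` form a basis of the
residue field `𝒪 / 𝔓` over the prime field `GF(p) = {0, …, p-1}`; thus `𝒪 / 𝔓` has
`q = p ^ c` elements. -/
structure IsResidueBasis {K : Type*} [NontriviallyNormedField K] (p : ℕ) {c : ℕ} [NeZero c]
    (ε : Fin c → K) : Prop where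
  zero_eq_one : ε 0 = 1
  norm_eq_one : ∀ i, ‖ε i‖ = 1
  existsUnique_coeff : ∀ x : K, ‖x‖ ≤ 1 →
    ∃! a : Fin c → Fin p, ‖x - ∑ i, ((a i : ℕ) : K) * ε i‖ < 1

/-- For `b = ∑ i < c, aᵢ p ^ i` with digits `0 ≤ aᵢ < p`, this is `(∑ i < c, aᵢ εᵢ) ϖ⁻¹`. -/
def uDigit {K : Type*} [Field K] (p : ℕ) {c : ℕ} (ϖ : K) (ε : Fin c → K) (b : ℕ) : K :=
  (∑ i : Fin c, ((b / p ^ (i : ℕ) % p : ℕ) : K) * ε i) * ϖ⁻¹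

/-- The translation parameters: for `n = ∑ k, bₖ q ^ k` with digits `0 ≤ bₖ < q = p ^ c`,
`u n = ∑ k, u(bₖ) ϖ ^ (-k)`, where `u(b)` is `uDigit` for `0 ≤ b < q`. (All the digits of `n`
with index `k > n` vanish.) -/
def u {K : Type*} [Field K] (p : ℕ) {c : ℕ} (ϖ : K) (ε : Fin c → K) (n : ℕ) : K :=
  ∑ k ∈ Finset.range (n + 1), uDigit p ϖ ε (n / (p ^ c) ^ k % p ^ c) * (ϖ⁻¹) ^ k

/-- `χ` is an admissible basic character of `K⁺`: a continuous unitary character, trivial on `𝒪`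
and nontrivial on `𝔓⁻¹ = ϖ⁻¹ 𝒪`, and normalized relative to `ϖ` and `ε` by
`χ (ε_μ ε_ν ϖ ^ (-j)) = 1` for `j ≥ 2`. (If the `GF(p)`-span of the `ε`'s is a subfield, the
normalization says `χ (ε_μ ϖ ^ (-j)) = 1` for all `μ` and all `j ≥ 2`.) -/
structure IsBasicCharacter {K : Type*} [NontriviallyNormedField K] {c : ℕ} (ϖ : K)
    (ε : Fin c → K) (χ : AddChar K Circle) : Prop where
  continuous : Continuous χ
  trivial_on_integers : ∀ x : K, ‖x‖ ≤ 1 → χ x = 1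
  nontrivial : ∃ x : K, ‖ϖ * x‖ ≤ 1 ∧ χ x ≠ 1
  normalized : ∀ (μ ν : Fin c) (j : ℕ), 2 ≤ j → χ (ε μ * ε ν * (ϖ⁻¹) ^ j) = 1

/-- `f` is integral periodic: periodic with respect to all `u l`, `l ≥ 0`. -/
def IntegralPeriodic {K : Type*} [Field K] (p : ℕ) {c : ℕ} (ϖ : K) (ε : Fin c → K)
    (f : K → ℂ) : Prop :=
  ∀ (l : ℕ) (x : K), f (x + u p ϖ ε l) = f x

/-! ### The Fourier transform on `L²(K)` -/

section Fourier

variable {K : Type*} [NontriviallyNormedField K] [MeasurableSpace K]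

/-- The Fourier integral of `f` truncated to the compact ball of radius `n`:
`∫_{‖x‖ ≤ n} f(x) χ(-ξ x) dx`. -/
def truncatedFourier (μ : Measure K) (χ : AddChar K Circle) (f : K → ℂ) (n : ℕ) (ξ : K) : ℂ :=
  ∫ x in Metric.closedBall (0 : K) (n : ℝ), f x * (χ (-(ξ * x)) : ℂ) ∂μ

/-- `g` is the Fourier transform of `f ∈ L²(K)`: the `L²`-limit, as `n → ∞`, of the Fourier
integrals of the integrable functions `f · 1_{‖x‖ ≤ n}`. -/
def IsFourierTransform (μ : Measure K) (χ : AddChar K Circle) (f g : Lp ℂ 2 μ) : Prop :=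
  Tendsto (fun n : ℕ => eLpNorm (fun ξ => truncatedFourier μ χ f n ξ - g ξ) 2 μ) atTop (𝓝 0)

open Classical in
/-- The Fourier transform on `L²(K)`. (The limit defining it is unique, and it always exists by
Plancherel's theorem, so the default value is never taken.) -/
def fourier (μ : Measure K) (χ : AddChar K Circle) (f : Lp ℂ 2 μ) : Lp ℂ 2 μ :=
  if h : ∃ g : Lp ℂ 2 μ, IsFourierTransform μ χ f g then h.choose else 0

end Fourier

/-! ### Translations and dilations of `L²(K)` -/

section Operators

variable {K : Type*} [NontriviallyNormedField K] [LocallyCompactSpace K]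
  [MeasurableSpace K] [BorelSpace K]

/-- The translation `f ↦ f(· - a)` of `L²(K)`. -/
def translate (μ : Measure K) [μ.IsAddHaarMeasure] (a : K) (f : Lp ℂ 2 μ) : Lp ℂ 2 μ :=
  Lp.compMeasurePreserving (fun x => x - a) (measurePreserving_sub_right μ a) f

theorem memLp_dilate (μ : Measure K) [μ.IsAddHaarMeasure] (r : ℂ) {a : K} (ha : a ≠ 0)
    (f : Lp ℂ 2 μ) : MemLp (fun x => r * f (a * x)) 2 μ := by
  have : ProperSpace K := ProperSpace.of_locallyCompactSpace K
  have hc : Continuous fun x : K => a * x := continuous_const.mul continuous_id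
  let e : K ≃+ K := AddEquiv.mk' (Equiv.mulLeft₀ a ha) (fun x y => mul_add a x y)
  have he : Continuous e := hc
  have hes : Continuous e.symm := by
    change Continuous fun x : K => a⁻¹ * x
    exact continuous_const.mul continuous_id
  have hH : (μ.map (fun x : K => a * x)).IsAddHaarMeasure :=
    AddEquiv.isAddHaarMeasure_map μ e he hes
  have hs := Measure.isAddLeftInvariant_eq_smul (μ.map (fun x : K => a * x)) μ
  have hm : MemLp f 2 (μ.map (fun x : K => a * x)) := by
    rw [hs]
    exact (Lp.memLp f).smul_measure ENNReal.coe_ne_top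
  exact (hm.comp_of_map hc.measurable.aemeasurable).const_mul r

/-- The dilation `D^j f (x) = q^{j/2} f(ϖ^{-j} x)` of `L²(K)`, for `j : ℤ`. -/
def dilate (μ : Measure K) [μ.IsAddHaarMeasure] (q : ℕ) {ϖ : K} (hϖ : ϖ ≠ 0) (j : ℤ)
    (f : Lp ℂ 2 μ) : Lp ℂ 2 μ :=
  (memLp_dilate μ (((q : ℝ) ^ ((j : ℝ) / 2) : ℝ) : ℂ) (zpow_ne_zero (-j) hϖ) f).toLp

end Operators

/-! ### Parseval frames and Parseval multiresolution analyses -/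

/-- The system `e` is a Parseval frame for the subspace `V`: it is contained in `V` and
`∑ₖ |⟨f, eₖ⟩|² = ‖f‖²` for all `f ∈ V`. -/
def IsParsevalFrame {H : Type*} [NormedAddCommGroup H] [InnerProductSpace ℂ H]
    (e : ℕ → H) (V : Submodule ℂ H) : Prop :=
  (∀ k, e k ∈ V) ∧ ∀ f ∈ V, HasSum (fun k => ‖inner ℂ f (e k)‖ ^ 2) (‖f‖ ^ 2)

section MRA

variable {K : Type*} [NontriviallyNormedField K] [LocallyCompactSpace K]
  [MeasurableSpace K] [BorelSpace K]

/-- The system of translates `T_k φ = φ(· - u k)`, `k ≥ 0`. -/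
def translates (μ : Measure K) [μ.IsAddHaarMeasure] (p : ℕ) {c : ℕ} (ϖ : K) (ε : Fin c → K)
    (φ : Lp ℂ 2 μ) (k : ℕ) : Lp ℂ 2 μ :=
  translate μ (u p ϖ ε k) φ

/-- `(D^j V)_{j ∈ ℤ}` is a Parseval multiresolution analysis of `L²(K)` with core space `V` and
Parseval scaling function `φ`. -/
structure IsParsevalMRA (μ : Measure K) [μ.IsAddHaarMeasure] (p : ℕ) {c : ℕ} {ϖ : K}
    (hϖ : ϖ ≠ 0) (ε : Fin c → K) (V : Submodule ℂ (Lp ℂ 2 μ)) (φ : Lp ℂ 2 μ) : Prop where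
  isClosed : IsClosed (V : Set (Lp ℂ 2 μ))
  translate_image : ∀ k : ℕ, translate μ (u p ϖ ε k) '' (V : Set (Lp ℂ 2 μ)) = V
  subset_dilate : (V : Set (Lp ℂ 2 μ)) ⊆ dilate μ (p ^ c) hϖ 1 '' V
  iInter_dilate : ⋂ j : ℤ, dilate μ (p ^ c) hϖ j '' (V : Set (Lp ℂ 2 μ)) = {0}
  closure_iUnion_dilate :
    closure (⋃ j : ℤ, dilate μ (p ^ c) hϖ j '' (V : Set (Lp ℂ 2 μ))) = Set.univ
  scaling_mem : φ ∈ V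
  scaling_frame : IsParsevalFrame (translates μ p ϖ ε φ) V

/-- `φ` is a Parseval scaling function associated with some Parseval MRA of `L²(K)`. -/
def IsParsevalScalingFunction (μ : Measure K) [μ.IsAddHaarMeasure] (p : ℕ) {c : ℕ} {ϖ : K}
    (hϖ : ϖ ≠ 0) (ε : Fin c → K) (φ : Lp ℂ 2 μ) : Prop :=
  ∃ V : Submodule ℂ (Lp ℂ 2 μ), IsParsevalMRA μ p hϖ ε V φ

end MRA

end

end LocalFieldMRA

set_option linter.unusedSectionVars false

namespace LocalFieldMRA

section DigitExpansions

variable {K : Type*} [NontriviallyNormedField K] {p : ℕ} {c : ℕ} {ϖ : K} {ε : Fin c → K}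

/-- The element of `𝒪` with the `GF(p)`-coordinates `a` modulo `𝔓`. -/
def residueRep (ε : Fin c → K) (a : Fin c → Fin p) : K := ∑ i, ((a i : ℕ) : K) * ε i

theorem uDigit_finFunctionFinEquiv (a : Fin c → Fin p) :
    uDigit p ϖ ε (finFunctionFinEquiv a : Fin (p ^ c)) = residueRep ε a * ϖ⁻¹ := by
  unfold uDigit residueRep
  congr 1
  refine Finset.sum_congr rfl fun i _ => ?_
  congr 2
  have h := congrArg (fun f : Fin c → Fin p => (f i : ℕ))
    (finFunctionFinEquiv.symm_apply_apply a)
  exact h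

theorem exists_uDigit_eq {b : ℕ} (hb : b < p ^ c) :
    ∃ a : Fin c → Fin p, (finFunctionFinEquiv a : Fin (p ^ c)) = b ∧
      uDigit p ϖ ε b = residueRep ε a * ϖ⁻¹ := by
  refine ⟨finFunctionFinEquiv.symm ⟨b, hb⟩, by simp, ?_⟩
  rw [← uDigit_finFunctionFinEquiv, Equiv.apply_symm_apply]

theorem uDigit_zero : uDigit p ϖ ε 0 = 0 := by simp [uDigit]

variable [hp : Fact p.Prime] [NeZero c]

theorem one_lt_card_residue (p c : ℕ) [hp : Fact p.Prime] [NeZero c] : 1 < p ^ c :=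
  Nat.one_lt_pow (NeZero.ne c) hp.out.one_lt

theorem u_eq_sum_of_lt {n N : ℕ} (h : n < N) :
    u p ϖ ε n = ∑ k ∈ Finset.range N, uDigit p ϖ ε (n / (p ^ c) ^ k % p ^ c) * (ϖ⁻¹) ^ k := by
  unfold u
  refine Finset.sum_subset (by simpa using h) fun k _ hk => ?_
  have hk : n < k := by simpa using hk
  have : n < (p ^ c) ^ k := hk.trans (Nat.lt_pow_self (one_lt_card_residue p c))
  rw [Nat.div_eq_of_lt this, Nat.zero_mod, uDigit_zero, zero_mul]

theorem u_zero : u p ϖ ε 0 = 0 := by simp [u, uDigit_zero]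

theorem u_add_mul {b : ℕ} (hb : b < p ^ c) (m : ℕ) :
    u p ϖ ε (b + p ^ c * m) = uDigit p ϖ ε b + ϖ⁻¹ * u p ϖ ε m := by
  have hq := one_lt_card_residue p c
  have hm : m ≤ p ^ c * m := Nat.le_mul_of_pos_left m (by omega)
  rw [u_eq_sum_of_lt (n := m) (N := b + p ^ c * m + 1) (by omega),
    u_eq_sum_of_lt (n := b + p ^ c * m) (N := b + p ^ c * m + 1 + 1) (by omega),
    Finset.sum_range_succ', add_comm, Finset.mul_sum]
  congr 1
  · simp [Nat.mod_eq_of_lt hb]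
  · refine Finset.sum_congr rfl fun k _ => ?_
    rw [pow_succ' (p ^ c), ← Nat.div_div_eq_div_mul, Nat.add_mul_div_left _ _ (by omega),
      Nat.div_eq_of_lt hb, zero_add]
    ring

theorem inv_mul_u (m : ℕ) : ϖ⁻¹ * u p ϖ ε m = u p ϖ ε (p ^ c * m) := by
  have := u_add_mul (p := p) (ϖ := ϖ) (ε := ε) (Nat.pos_of_ne_zero (NeZero.ne (p ^ c))) m
  rw [zero_add, uDigit_zero, zero_add] at this
  exact this.symm

variable [CharP K p]

theorem exists_residueRep_add (a a' : Fin c → Fin p) :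
    ∃ d : Fin c → Fin p, residueRep ε d = residueRep ε a + residueRep ε a' := by
  refine ⟨fun i => a i + a' i, ?_⟩
  unfold residueRep
  rw [← Finset.sum_add_distrib]
  refine Finset.sum_congr rfl fun i _ => ?_
  rw [← add_mul, Fin.val_add, ← Nat.cast_add]
  congr 1
  exact CharP.cast_eq_mod K p _ |>.symm

theorem exists_u_add (k l : ℕ) : ∃ m, u p ϖ ε m = u p ϖ ε k + u p ϖ ε l := by
  have hq := one_lt_card_residue p c
  induction k using Nat.strong_induction_on generalizing l with
  | _ k ih =>
    rcases Nat.eq_zero_or_pos k with rfl | hk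
    · exact ⟨l, by rw [u_zero, zero_add]⟩
    obtain ⟨m, hm⟩ := ih (k / p ^ c) (Nat.div_lt_self hk hq) (l / p ^ c)
    obtain ⟨a, -, ha⟩ := exists_uDigit_eq (p := p) (ϖ := ϖ) (ε := ε)
      (Nat.mod_lt k (by omega : 0 < p ^ c))
    obtain ⟨a', -, ha'⟩ := exists_uDigit_eq (p := p) (ϖ := ϖ) (ε := ε)
      (Nat.mod_lt l (by omega : 0 < p ^ c))
    obtain ⟨d, hd⟩ := exists_residueRep_add (ε := ε) a a'
    refine ⟨(finFunctionFinEquiv d : Fin (p ^ c)) + p ^ c * m, ?_⟩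
    rw [u_add_mul (Fin.is_lt _), uDigit_finFunctionFinEquiv, hd, hm]
    conv_rhs => rw [← Nat.mod_add_div k (p ^ c), ← Nat.mod_add_div l (p ^ c),
      u_add_mul (Nat.mod_lt k (by omega)), u_add_mul (Nat.mod_lt l (by omega)), ha, ha']
    ring

theorem exists_u_neg (k : ℕ) : ∃ m, u p ϖ ε m = -u p ϖ ε k := by
  have key : ∀ n : ℕ, ∃ m, u p ϖ ε m = n * u p ϖ ε k := by
    intro n
    induction n with
    | zero => exact ⟨0, by simp [u_zero]⟩
    | succ n ih =>
      obtain ⟨m, hm⟩ := ih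
      obtain ⟨m', hm'⟩ := exists_u_add (p := p) (ϖ := ϖ) (ε := ε) m k
      exact ⟨m', by rw [hm', hm]; push_cast; ring⟩
  obtain ⟨m, hm⟩ := key (p - 1)
  refine ⟨m, ?_⟩
  rw [hm, Nat.cast_sub hp.out.one_lt.le, CharP.cast_eq_zero]
  simp

theorem IsPrimeElement.norm_pos (hϖ : IsPrimeElement ϖ) : 0 < ‖ϖ‖ := norm_pos_iff.mpr hϖ.ne_zero

theorem IsPrimeElement.inv_norm_le (hϖ : IsPrimeElement ϖ) {x : K} (hx : 1 < ‖x‖) :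
    ‖ϖ‖⁻¹ ≤ ‖x‖ := by
  have h := hϖ.norm_le x⁻¹ (by rw [norm_inv]; exact inv_lt_one_of_one_lt₀ hx)
  rw [norm_inv] at h
  exact inv_le_of_inv_le₀ (by linarith) h

variable [IsUltrametricDist K]

theorem norm_sub_le_max_ultra (x y : K) : ‖x - y‖ ≤ max ‖x‖ ‖y‖ := by
  simpa [sub_eq_add_neg] using IsUltrametricDist.norm_add_le_max x (-y)

theorem norm_residueRep_le (hε : IsResidueBasis p ε) (a : Fin c → Fin p) :
    ‖residueRep ε a‖ ≤ 1 := by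
  refine IsUltrametricDist.norm_sum_le_of_forall_le_of_nonneg zero_le_one fun i _ => ?_
  rw [norm_mul, hε.norm_eq_one, mul_one]
  exact IsUltrametricDist.norm_natCast_le_one K _

theorem residueRep_injective (hε : IsResidueBasis p ε) {a a' : Fin c → Fin p}
    (h : ‖residueRep ε a - residueRep ε a'‖ < 1) : a = a' := by
  obtain ⟨b, -, hb⟩ := hε.existsUnique_coeff (residueRep ε a) (norm_residueRep_le hε a)
  rw [hb a (by simp [residueRep]), hb a' h]

theorem exists_norm_sub_residueRep_le (hϖ : IsPrimeElement ϖ) (hε : IsResidueBasis p ε) {x : K}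
    (hx : ‖x‖ ≤ 1) : ∃ a : Fin c → Fin p, ‖x - residueRep ε a‖ ≤ ‖ϖ‖ := by
  obtain ⟨a, ha, -⟩ := hε.existsUnique_coeff x hx
  exact ⟨a, hϖ.norm_le _ ha⟩

theorem exists_norm_le_zpow (hϖ : IsPrimeElement ϖ) (R : ℝ) : ∃ n : ℕ, R ≤ ‖ϖ‖ ^ (-(n : ℤ)) := by
  obtain ⟨n, hn⟩ := pow_unbounded_of_one_lt R ((one_lt_inv₀ hϖ.norm_pos).mpr hϖ.norm_lt_one)
  exact ⟨n, by rw [zpow_neg, zpow_natCast, ← inv_pow]; exact hn.le⟩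

/-- Every element of `K` is congruent modulo `𝒪` to some `u k`. -/
theorem exists_norm_sub_u_le (hϖ : IsPrimeElement ϖ) (hε : IsResidueBasis p ε) (x : K) :
    ∃ k, ‖x - u p ϖ ε k‖ ≤ 1 := by
  have key : ∀ (n : ℕ) (x : K), ‖x‖ ≤ ‖ϖ‖ ^ (-(n : ℤ)) → ∃ k, ‖x - u p ϖ ε k‖ ≤ 1 := by
    intro n
    induction n with
    | zero => exact fun x hx => ⟨0, by simpa [u_zero] using hx⟩
    | succ n ih =>
      intro x hx
      have h0 := hϖ.norm_pos
      obtain ⟨m, hm⟩ := ih (ϖ * x) (by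
        rw [norm_mul]
        calc ‖ϖ‖ * ‖x‖ ≤ ‖ϖ‖ * ‖ϖ‖ ^ (-((n + 1 : ℕ) : ℤ)) := by gcongr
          _ = ‖ϖ‖ ^ (-(n : ℤ)) := by
            rw [← zpow_one_add₀ h0.ne']; congr 1; push_cast; ring)
      obtain ⟨a, ha⟩ := exists_norm_sub_residueRep_le hϖ hε hm
      refine ⟨(finFunctionFinEquiv a : Fin (p ^ c)) + p ^ c * m, ?_⟩
      rw [u_add_mul (Fin.is_lt _), uDigit_finFunctionFinEquiv]
      have : x - (residueRep ε a * ϖ⁻¹ + ϖ⁻¹ * u p ϖ ε m) =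
          ϖ⁻¹ * (ϖ * x - u p ϖ ε m - residueRep ε a) := by
        field_simp [hϖ.ne_zero]
        ring
      rw [this, norm_mul, norm_inv]
      calc ‖ϖ‖⁻¹ * _ ≤ ‖ϖ‖⁻¹ * ‖ϖ‖ := by gcongr
        _ = 1 := inv_mul_cancel₀ h0.ne'
  obtain ⟨n, hn⟩ := exists_norm_le_zpow hϖ ‖x‖
  exact key n x hn

/-- Distinct elements `u k` are incongruent modulo `𝒪`. -/
theorem eq_of_norm_u_sub_le (hϖ : IsPrimeElement ϖ) (hε : IsResidueBasis p ε) {k l : ℕ}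
    (h : ‖u p ϖ ε k - u p ϖ ε l‖ ≤ 1) : k = l := by
  have hq := one_lt_card_residue p c
  obtain ⟨N, hkl⟩ : ∃ N, k + l ≤ N := ⟨_, le_rfl⟩
  induction N using Nat.strong_induction_on generalizing k l with
  | _ N ih =>
    rcases Nat.eq_zero_or_pos (k + l) with h0 | hpos
    · omega
    obtain ⟨a, hab, ha⟩ := exists_uDigit_eq (p := p) (ϖ := ϖ) (ε := ε)
      (Nat.mod_lt k (by omega : 0 < p ^ c))
    obtain ⟨a', hab', ha'⟩ := exists_uDigit_eq (p := p) (ϖ := ϖ) (ε := ε)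
      (Nat.mod_lt l (by omega : 0 < p ^ c))
    have hk := u_add_mul (ϖ := ϖ) (ε := ε) (Nat.mod_lt k (by omega : 0 < p ^ c)) (k / p ^ c)
    have hl := u_add_mul (ϖ := ϖ) (ε := ε) (Nat.mod_lt l (by omega : 0 < p ^ c)) (l / p ^ c)
    rw [Nat.mod_add_div, ha] at hk
    rw [Nat.mod_add_div, ha'] at hl
    have h1 : ‖(residueRep ε a - residueRep ε a') +
        (u p ϖ ε (k / p ^ c) - u p ϖ ε (l / p ^ c))‖ < 1 := by
      have : (residueRep ε a - residueRep ε a') + (u p ϖ ε (k / p ^ c) - u p ϖ ε (l / p ^ c)) =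
          ϖ * (u p ϖ ε k - u p ϖ ε l) := by
        rw [hk, hl]
        field_simp [hϖ.ne_zero]
        ring
      rw [this, norm_mul]
      calc _ ≤ ‖ϖ‖ * 1 := by gcongr
        _ < 1 := by simpa using hϖ.norm_lt_one
    have hr : ‖residueRep ε a - residueRep ε a'‖ ≤ 1 :=
      (norm_sub_le_max_ultra _ _).trans
        (max_le (norm_residueRep_le hε a) (norm_residueRep_le hε a'))
    have h2 : k / p ^ c = l / p ^ c := by
      have hlt : k / p ^ c + l / p ^ c < k + l := by
        have h3 := Nat.div_le_self k (p ^ c)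
        have h4 := Nat.div_le_self l (p ^ c)
        rcases Nat.eq_zero_or_pos k with rfl | hk0
        · have := Nat.div_lt_self (show 0 < l by omega) hq
          omega
        · have := Nat.div_lt_self hk0 hq
          omega
      refine ih _ (hlt.trans_le hkl) ?_ le_rfl
      have := norm_sub_le_max_ultra ((residueRep ε a - residueRep ε a') +
        (u p ϖ ε (k / p ^ c) - u p ϖ ε (l / p ^ c))) (residueRep ε a - residueRep ε a')
      rw [add_sub_cancel_left] at this
      exact this.trans (max_le h1.le hr)
    rw [h2, sub_self, add_zero] at h1
    have h3 := residueRep_injective hε h1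
    rw [← Nat.mod_add_div k (p ^ c), ← Nat.mod_add_div l (p ^ c), h2, ← hab, ← hab', h3]

end DigitExpansions

section BasicCharacter

variable {K : Type*} [NontriviallyNormedField K] {p : ℕ} {c : ℕ} {ϖ : K} {ε : Fin c → K}
  {χ : AddChar K Circle}

theorem IsBasicCharacter.map_sum {ι : Type*} (χ : AddChar K Circle) (s : Finset ι) (f : ι → K)
    (h : ∀ i ∈ s, χ (f i) = 1) : χ (∑ i ∈ s, f i) = 1 := by
  classical
  induction s using Finset.induction_on with
  | empty => simp
  | insert i s hi ih =>
    rw [Finset.sum_insert hi, AddChar.map_add_eq_mul, h i (by simp),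
      ih fun j hj => h j (by simp [hj]), one_mul]

theorem IsBasicCharacter.map_natCast_mul (χ : AddChar K Circle) {x : K} (h : χ x = 1) (n : ℕ) :
    χ (n * x) = 1 := by
  rw [← nsmul_eq_mul, AddChar.map_nsmul_eq_pow, h, one_pow]

/-- The set `{u k}` is self-orthogonal for the pairing `(x, y) ↦ χ (x y)`. -/
theorem IsBasicCharacter.map_u_mul_u (hχ : IsBasicCharacter ϖ ε χ) (k l : ℕ) :
    χ (u p ϖ ε k * u p ϖ ε l) = 1 := by
  unfold u uDigit
  rw [Finset.sum_mul_sum]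
  refine map_sum χ _ _ fun i _ => map_sum χ _ _ fun j _ => ?_
  simp only [Finset.sum_mul, Finset.mul_sum]
  refine map_sum χ _ _ fun ν _ => map_sum χ _ _ fun μ _ => ?_
  have h := hχ.normalized μ ν (i + j + 2) (by omega)
  generalize k / (p ^ c) ^ i % p ^ c / p ^ (μ : ℕ) % p = a
  generalize l / (p ^ c) ^ j % p ^ c / p ^ (ν : ℕ) % p = b
  have := map_natCast_mul χ h (a * b)
  rw [← this]
  congr 1
  push_cast
  ring

/-- `𝒪` is its own annihilator for the pairing `(x, y) ↦ χ (x y)`. -/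
theorem IsBasicCharacter.exists_ne_one (hϖ : IsPrimeElement ϖ) (hχ : IsBasicCharacter ϖ ε χ)
    {x : K} {r : ℝ} (hr : 0 < r) (hx : r < ‖x‖) (hrϖ : ∃ n : ℤ, r = ‖ϖ‖ ^ n) :
    ∃ y : K, ‖y‖ ≤ r⁻¹ ∧ χ (x * y) ≠ 1 := by
  obtain ⟨z, hz, hz1⟩ := hχ.nontrivial
  obtain ⟨n, rfl⟩ := hrϖ
  have hx0 : 0 < ‖x‖ := hr.trans hx
  refine ⟨x⁻¹ * z, ?_, ?_⟩
  · have h1 : ‖ϖ‖⁻¹ ≤ ‖ϖ ^ (-n) * x‖ := by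
      refine hϖ.inv_norm_le ?_
      rw [norm_mul, norm_zpow, zpow_neg, ← div_eq_inv_mul]
      exact (one_lt_div hr).mpr hx
    rw [norm_mul, norm_zpow, zpow_neg] at h1
    rw [norm_mul] at hz
    rw [norm_mul, norm_inv]
    have h0 := hϖ.norm_pos
    have hz' : ‖z‖ ≤ ‖ϖ‖⁻¹ := by rw [← one_div]; exact (le_div_iff₀' h0).mpr hz
    calc ‖x‖⁻¹ * ‖z‖ ≤ ‖x‖⁻¹ * ((‖ϖ‖ ^ n)⁻¹ * ‖x‖) := by gcongr; exact hz'.trans h1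
      _ = (‖ϖ‖ ^ n)⁻¹ := by field_simp
  · rwa [mul_inv_cancel_left₀ (norm_pos_iff.mp hx0)]

end BasicCharacter

/-- The arithmetic data of the local field, with normalized Haar measure and basic character. -/
structure Admissible {K : Type*} [NontriviallyNormedField K] [MeasurableSpace K]
    (μ : Measure K) (p : ℕ) {c : ℕ} [NeZero c] (ϖ : K) (ε : Fin c → K) (χ : AddChar K Circle) :
    Prop where
  measure_integers : μ (Metric.closedBall (0 : K) 1) = 1
  prime : IsPrimeElement ϖ
  basis : IsResidueBasis p ε
  character : IsBasicCharacter ϖ ε χ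

/-- The fractional ideal `ϖ ^ n 𝒪`. -/
def fracIdeal {K : Type*} [NontriviallyNormedField K] (ϖ : K) (n : ℤ) : Set K :=
  Metric.closedBall 0 (‖ϖ‖ ^ n)

section FractionalIdeals

variable {K : Type*} [NontriviallyNormedField K] {ϖ : K}

theorem mem_fracIdeal {n : ℤ} {x : K} : x ∈ fracIdeal ϖ n ↔ ‖x‖ ≤ ‖ϖ‖ ^ n := by
  simp [fracIdeal]

theorem fracIdeal_zero : fracIdeal ϖ 0 = Metric.closedBall (0 : K) 1 := by simp [fracIdeal]

theorem zpow_mul_mem_fracIdeal (hϖ : IsPrimeElement ϖ) {m n : ℤ} {x : K} :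
    ϖ ^ m * x ∈ fracIdeal ϖ n ↔ x ∈ fracIdeal ϖ (n - m) := by
  have h0 := hϖ.norm_pos
  rw [mem_fracIdeal, mem_fracIdeal, norm_mul, norm_zpow, zpow_sub₀ h0.ne',
    le_div_iff₀' (zpow_pos h0 m)]

theorem fracIdeal_antitone (hϖ : IsPrimeElement ϖ) {m n : ℤ} (h : m ≤ n) :
    fracIdeal ϖ n ⊆ fracIdeal ϖ m :=
  Metric.closedBall_subset_closedBall
    (zpow_le_zpow_right_of_le_one₀ hϖ.norm_pos hϖ.norm_lt_one.le h)

variable [IsUltrametricDist K]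

theorem exists_closedBall_subset_fracIdeal (hϖ : IsPrimeElement ϖ) (R : ℝ) :
    ∃ n : ℕ, Metric.closedBall (0 : K) R ⊆ fracIdeal ϖ (-(n : ℤ)) := by
  obtain ⟨n, hn⟩ := exists_norm_le_zpow hϖ R
  exact ⟨n, Metric.closedBall_subset_closedBall hn⟩

theorem add_mem_fracIdeal {n : ℤ} {x y : K} (hx : x ∈ fracIdeal ϖ n) (hy : y ∈ fracIdeal ϖ n) :
    x + y ∈ fracIdeal ϖ n := by
  rw [mem_fracIdeal] at *
  exact (IsUltrametricDist.norm_add_le_max x y).trans (max_le hx hy)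

theorem neg_mem_fracIdeal {n : ℤ} {x : K} : -x ∈ fracIdeal ϖ n ↔ x ∈ fracIdeal ϖ n := by
  simp [mem_fracIdeal]

theorem sub_mem_fracIdeal {n : ℤ} {x y : K} (hx : x ∈ fracIdeal ϖ n) (hy : y ∈ fracIdeal ϖ n) :
    x - y ∈ fracIdeal ϖ n := by
  rw [sub_eq_add_neg]
  exact add_mem_fracIdeal hx (neg_mem_fracIdeal.mpr hy)

theorem add_mem_fracIdeal_iff {n : ℤ} {x y : K} (hy : y ∈ fracIdeal ϖ n) :
    x + y ∈ fracIdeal ϖ n ↔ x ∈ fracIdeal ϖ n :=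
  ⟨fun h => by simpa using sub_mem_fracIdeal h hy, fun h => add_mem_fracIdeal h hy⟩

end FractionalIdeals

section Measure

variable {K : Type*} [NontriviallyNormedField K] [IsUltrametricDist K] [ProperSpace K]
  [MeasurableSpace K] [BorelSpace K] {μ : Measure K} [μ.IsAddHaarMeasure]
  {p : ℕ} [hp : Fact p.Prime] [CharP K p] {c : ℕ} [NeZero c] {ϖ : K} {ε : Fin c → K}
  {χ : AddChar K Circle}

theorem measurableSet_fracIdeal (ϖ : K) (n : ℤ) : MeasurableSet (fracIdeal ϖ n) :=
  measurableSet_closedBall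

theorem measure_fracIdeal_lt_top (ϖ : K) (n : ℤ) : μ (fracIdeal ϖ n) < ∞ :=
  measure_closedBall_lt_top

theorem Admissible.measure_fracIdeal_one (S : Admissible μ p ϖ ε χ) :
    ((p ^ c : ℕ) : ℝ≥0∞) * μ (fracIdeal ϖ 1) = 1 := by
  have h : Metric.closedBall (0 : K) 1 =
      ⋃ a : Fin c → Fin p, (fun x => x - residueRep ε a) ⁻¹' fracIdeal ϖ 1 := by
    ext x
    simp only [mem_closedBall_zero_iff, Set.mem_iUnion, Set.mem_preimage, mem_fracIdeal, zpow_one]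
    constructor
    · exact exists_norm_sub_residueRep_le S.prime S.basis
    · rintro ⟨a, ha⟩
      have := IsUltrametricDist.norm_add_le_max (x - residueRep ε a) (residueRep ε a)
      rw [sub_add_cancel] at this
      exact this.trans (max_le (ha.trans S.prime.norm_lt_one.le) (norm_residueRep_le S.basis a))
  rw [← S.measure_integers, h, measure_iUnion]
  · simp_rw [(measurePreserving_sub_right μ _).measure_preimage
      (measurableSet_fracIdeal ϖ 1).nullMeasurableSet]
    simp
  · intro a b hab
    refine Set.disjoint_left.mpr fun x hx hy => hab (residueRep_injective S.basis ?_)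
    have := sub_mem_fracIdeal hy hx
    rw [sub_sub_sub_cancel_left, mem_fracIdeal, zpow_one] at this
    exact this.trans_lt S.prime.norm_lt_one
  · exact fun a => (measurable_id.sub_const _) (measurableSet_fracIdeal ϖ 1)

theorem cardResidue_ne_zero (p c : ℕ) [hp : Fact p.Prime] : ((p ^ c : ℕ) : ℝ≥0∞) ≠ 0 := by
  exact_mod_cast (pow_pos hp.out.pos c).ne'

/-- Multiplication by `ϖ ^ n` scales the Haar measure by `q ^ (-n)`. -/
theorem Admissible.map_zpow_mul (S : Admissible μ p ϖ ε χ) (n : ℤ) :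
    μ.map (fun x => ϖ ^ n * x) = ((p ^ c : ℕ) : ℝ≥0∞) ^ n • μ := by
  have hϖ0 := S.prime.ne_zero
  have hq0 := cardResidue_ne_zero p c
  have hqt : ((p ^ c : ℕ) : ℝ≥0∞) ≠ ∞ := ENNReal.natCast_ne_top _
  have hmeas (a : K) : Measurable fun x : K => a * x := measurable_const_mul a
  have hinv : μ.map (fun x => ϖ⁻¹ * x) = ((p ^ c : ℕ) : ℝ≥0∞)⁻¹ • μ := by
    let e : K ≃+ K := AddEquiv.mk' (Equiv.mulLeft₀ ϖ⁻¹ (inv_ne_zero hϖ0)) (fun x y => mul_add _ x y)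
    have he : Continuous e := continuous_const_mul ϖ⁻¹
    have hes : Continuous e.symm := by
      change Continuous fun x : K => ϖ⁻¹⁻¹ * x
      exact continuous_const_mul _
    have : (μ.map (fun x : K => ϖ⁻¹ * x)).IsAddHaarMeasure :=
      AddEquiv.isAddHaarMeasure_map μ e he hes
    have h := Measure.isAddLeftInvariant_eq_smul (μ.map (fun x : K => ϖ⁻¹ * x)) μ
    have h2 := congrArg (fun ν : Measure K => ν (Metric.closedBall (0 : K) 1)) h
    simp only [Measure.smul_apply, S.measure_integers] at h2
    rw [Measure.map_apply (hmeas _) measurableSet_closedBall] at h2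
    have h3 : (fun x => ϖ⁻¹ * x) ⁻¹' Metric.closedBall (0 : K) 1 = fracIdeal ϖ 1 := by
      ext x
      rw [Set.mem_preimage, ← fracIdeal_zero (ϖ := ϖ), ← zpow_neg_one,
        zpow_mul_mem_fracIdeal S.prime]
      norm_num
    rw [h3, ENNReal.smul_def, smul_eq_mul, mul_one] at h2
    rw [h, ENNReal.smul_def, ← h2, ENNReal.eq_inv_of_mul_eq_one_left
      ((mul_comm _ _).trans S.measure_fracIdeal_one)]
  have hone : μ.map (fun x => ϖ * x) = ((p ^ c : ℕ) : ℝ≥0∞) • μ := by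
    have h := congrArg (fun ν : Measure K => ν.map fun x => ϖ * x) hinv
    simp only [Measure.map_smul] at h
    rw [Measure.map_map (hmeas _) (hmeas _)] at h
    have hid : ((fun x => ϖ * x) ∘ fun x => ϖ⁻¹ * x) = (id : K → K) := by
      funext x
      simp [hϖ0]
    rw [hid, Measure.map_id] at h
    conv_rhs => rw [h]
    rw [smul_smul, ENNReal.mul_inv_cancel hq0 hqt, one_smul]
  induction n using Int.induction_on with
  | zero => simp
  | succ n ih =>
    have : (fun x : K => ϖ ^ ((n : ℤ) + 1) * x) = (fun x => ϖ * x) ∘ fun x => ϖ ^ (n : ℤ) * x := by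
      funext x
      simp only [Function.comp, zpow_add_one₀ hϖ0]
      ring
    rw [this, ← Measure.map_map (hmeas _) (hmeas _), ih, Measure.map_smul, hone, smul_smul,
      ENNReal.zpow_add hq0 hqt, zpow_one]
  | pred n ih =>
    have : (fun x : K => ϖ ^ (-(n : ℤ) - 1) * x) =
        (fun x => ϖ⁻¹ * x) ∘ fun x => ϖ ^ (-(n : ℤ)) * x := by
      funext x
      simp only [Function.comp, zpow_sub_one₀ hϖ0]
      ring
    rw [this, ← Measure.map_map (hmeas _) (hmeas _), ih, Measure.map_smul, hinv, smul_smul,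
      sub_eq_add_neg, ENNReal.zpow_add hq0 hqt, zpow_neg_one]

theorem Admissible.lintegral_zpow_mul (S : Admissible μ p ϖ ε χ) (n : ℤ) (h : K → ℝ≥0∞) :
    ∫⁻ x, h (ϖ ^ n * x) ∂μ = ((p ^ c : ℕ) : ℝ≥0∞) ^ n * ∫⁻ x, h x ∂μ := by
  have he : MeasurableEmbedding fun x : K => ϖ ^ n * x :=
    (Homeomorph.mulLeft₀ _ (zpow_ne_zero n S.prime.ne_zero)).measurableEmbedding
  rw [← he.lintegral_map, S.map_zpow_mul, lintegral_smul_measure, smul_eq_mul]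

theorem Admissible.integral_zpow_mul (S : Admissible μ p ϖ ε χ) {E : Type*} [NormedAddCommGroup E]
    [NormedSpace ℝ E] (n : ℤ) (h : K → E) :
    ∫ x, h (ϖ ^ n * x) ∂μ = (((p ^ c : ℕ) : ℝ) ^ n : ℝ) • ∫ x, h x ∂μ := by
  have he : MeasurableEmbedding fun x : K => ϖ ^ n * x :=
    (Homeomorph.mulLeft₀ _ (zpow_ne_zero n S.prime.ne_zero)).measurableEmbedding
  rw [← he.integral_map, S.map_zpow_mul, integral_smul_measure]
  congr 1
  cases n <;> simp [zpow_negSucc]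

theorem Admissible.quasiMeasurePreserving (S : Admissible μ p ϖ ε χ) (n : ℤ) :
    Measure.QuasiMeasurePreserving (fun x => ϖ ^ n * x) μ μ :=
  ⟨measurable_const_mul _, by rw [S.map_zpow_mul]; exact Measure.smul_absolutelyContinuous⟩

/-- `K` is the disjoint union of the translates `u k + 𝒪`. -/
theorem Admissible.iUnion_preimage (S : Admissible μ p ϖ ε χ) :
    ⋃ k, (fun x => x - u p ϖ ε k) ⁻¹' Metric.closedBall (0 : K) 1 = Set.univ := by
  refine Set.eq_univ_of_forall fun x => ?_
  simpa using exists_norm_sub_u_le S.prime S.basis x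

theorem Admissible.pairwise_disjoint_preimage (S : Admissible μ p ϖ ε χ) :
    Pairwise (Function.onFun Disjoint
      fun k => (fun x => x - u p ϖ ε k) ⁻¹' Metric.closedBall (0 : K) 1) := by
  intro k l hkl
  refine Set.disjoint_left.mpr fun x hx hy => hkl ?_
  simp only [Set.mem_preimage, mem_closedBall_zero_iff] at hx hy
  refine eq_of_norm_u_sub_le (p := p) S.prime S.basis ?_
  have := norm_sub_le_max_ultra (x - u p ϖ ε l) (x - u p ϖ ε k)
  rw [sub_sub_sub_cancel_left] at this
  exact this.trans (max_le hy hx)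

theorem Admissible.lintegral_eq_tsum_add (S : Admissible μ p ϖ ε χ) (h : K → ℝ≥0∞) :
    ∫⁻ x, h x ∂μ = ∑' k, ∫⁻ x in Metric.closedBall (0 : K) 1, h (x + u p ϖ ε k) ∂μ := by
  rw [← setLIntegral_univ, ← S.iUnion_preimage, lintegral_iUnion]
  · refine tsum_congr fun k => ?_
    have := (measurePreserving_sub_right μ (u p ϖ ε k)).setLIntegral_comp_preimage_emb
      (MeasurableEquiv.subRight (u p ϖ ε k)).measurableEmbedding
      (fun x => h (x + u p ϖ ε k)) (Metric.closedBall (0 : K) 1)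
    simpa using this
  · exact fun k => (measurable_id.sub_const _) measurableSet_closedBall
  · exact S.pairwise_disjoint_preimage

theorem Admissible.lintegral_eq_tsum_sub (S : Admissible μ p ϖ ε χ) (h : K → ℝ≥0∞) :
    ∫⁻ x, h x ∂μ = ∑' k, ∫⁻ x in Metric.closedBall (0 : K) 1, h (x - u p ϖ ε k) ∂μ := by
  rw [← lintegral_neg_eq_self, S.lintegral_eq_tsum_add]
  refine tsum_congr fun k => ?_
  have := (Measure.measurePreserving_neg μ).setLIntegral_comp_preimage_emb
      (MeasurableEquiv.neg K).measurableEmbedding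
      (fun x => h (x - u p ϖ ε k)) (Metric.closedBall (0 : K) 1)
  simp only [Set.neg_preimage, neg_closedBall, neg_zero] at this
  rw [← this]
  exact lintegral_congr fun x => by rw [neg_add, sub_eq_add_neg]

/-- A property invariant under `x ↦ x - u k` that holds a.e. on `𝒪` holds a.e. -/
theorem Admissible.ae_of_ae_restrict (S : Admissible μ p ϖ ε χ) {P : K → Prop}
    (hP : ∀ k x, P (x - u p ϖ ε k) → P x)
    (h : ∀ᵐ x ∂μ.restrict (Metric.closedBall (0 : K) 1), P x) : ∀ᵐ x ∂μ, P x := by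
  rw [ae_restrict_iff' measurableSet_closedBall] at h
  have h' : ∀ᵐ x ∂μ, ∀ k, x - u p ϖ ε k ∈ Metric.closedBall (0 : K) 1 → P (x - u p ϖ ε k) :=
    ae_all_iff.mpr fun k =>
      (measurePreserving_sub_right μ (u p ϖ ε k)).quasiMeasurePreserving.ae h
  filter_upwards [h'] with x hx
  obtain ⟨k, hk⟩ := exists_norm_sub_u_le (p := p) S.prime S.basis x
  exact hP k x (hx k (by simpa using hk))

end Measure

section IntegersParseval

variable {K : Type*} [NontriviallyNormedField K] [IsUltrametricDist K] [ProperSpace K]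
  [MeasurableSpace K] [BorelSpace K] {μ : Measure K} [μ.IsAddHaarMeasure]
  {p : ℕ} [hp : Fact p.Prime] [CharP K p] {c : ℕ} [NeZero c] {ϖ : K} {ε : Fin c → K}
  {χ : AddChar K Circle}

theorem isPiSystem_closedBall (ϖ : K) :
    IsPiSystem {s : Set K | ∃ (a : K) (n : ℤ), s = Metric.closedBall a (‖ϖ‖ ^ n)} := by
  rintro s ⟨a, m, rfl⟩ t ⟨b, n, rfl⟩ hst
  rcases IsUltrametricDist.closedBall_subset_trichotomy (x := a) (y := b) (r := ‖ϖ‖ ^ m)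
    (s := ‖ϖ‖ ^ n) with h | h | h
  · exact ⟨a, m, Set.inter_eq_left.mpr h⟩
  · exact ⟨b, n, Set.inter_eq_right.mpr h⟩
  · exact absurd h (Set.not_disjoint_iff_nonempty_inter.mpr hst)

theorem isTopologicalBasis_closedBall (hϖ : IsPrimeElement ϖ) :
    TopologicalSpace.IsTopologicalBasis
      {s : Set K | ∃ (a : K) (n : ℤ), s = Metric.closedBall a (‖ϖ‖ ^ n)} := by
  refine TopologicalSpace.isTopologicalBasis_of_isOpen_of_nhds ?_ ?_
  · rintro s ⟨a, n, rfl⟩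
    exact IsUltrametricDist.isOpen_closedBall _ (zpow_ne_zero _ hϖ.norm_pos.ne')
  · intro a U ha hU
    obtain ⟨δ, hδ, hδU⟩ := Metric.isOpen_iff.mp hU a ha
    obtain ⟨n, hn⟩ := exists_pow_lt_of_lt_one hδ hϖ.norm_lt_one
    exact ⟨_, ⟨a, n, rfl⟩, Metric.mem_closedBall_self (zpow_nonneg (norm_nonneg _) _),
      (Metric.closedBall_subset_ball (by simpa using hn)).trans hδU⟩

/-- A locally integrable function whose integrals over all balls vanish is zero a.e. -/
theorem ae_eq_zero_of_forall_setIntegral_closedBall (hϖ : IsPrimeElement ϖ) {g : K → ℂ}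
    (hg : LocallyIntegrable g μ)
    (h : ∀ (a : K) (n : ℤ), ∫ x in Metric.closedBall a (‖ϖ‖ ^ n), g x ∂μ = 0) : g =ᵐ[μ] 0 := by
  have hint (N : ℕ) : IntegrableOn g (fracIdeal ϖ (-(N : ℤ))) μ :=
    hg.integrableOn_isCompact (isCompact_closedBall _ _)
  have key (N : ℕ) : ∀ A : Set K, MeasurableSet A →
      ∫ x in A, g x ∂μ.restrict (fracIdeal ϖ (-(N : ℤ))) = 0 := by
    refine MeasurableSpace.induction_on_inter
      ((BorelSpace.measurable_eq).trans (isTopologicalBasis_closedBall hϖ).borel_eq_generateFrom)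
      (isPiSystem_closedBall ϖ) (by simp) ?_ ?_ ?_
    · rintro t ⟨a, n, rfl⟩
      rw [Measure.restrict_restrict measurableSet_closedBall]
      rcases (Metric.closedBall a (‖ϖ‖ ^ n) ∩ fracIdeal ϖ (-(N : ℤ))).eq_empty_or_nonempty
        with h0 | h0
      · simp [h0]
      · obtain ⟨b, m, hbm⟩ := isPiSystem_closedBall ϖ _ ⟨a, n, rfl⟩ _ ⟨0, -(N : ℤ), rfl⟩ h0
        rw [fracIdeal, hbm, h]
    · intro t ht h0
      have h1 := integral_add_compl ht (hint N)
      rw [h0, zero_add] at h1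
      rw [h1]
      exact h 0 _
    · intro f hd hf h0
      rw [integral_iUnion hf hd (hint N).integrableOn]
      simp [h0]
  have hae (N : ℕ) : ∀ᵐ x ∂μ, x ∈ fracIdeal ϖ (-(N : ℤ)) → g x = 0 := by
    rw [← ae_restrict_iff' (measurableSet_fracIdeal ϖ _)]
    exact (hint N).ae_eq_zero_of_forall_setIntegral_eq_zero fun s hs _ => key N s hs
  filter_upwards [ae_all_iff.mpr hae] with x hx
  obtain ⟨N, hN⟩ := exists_norm_le_zpow hϖ ‖x‖
  exact hx N (mem_fracIdeal.mpr hN)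

theorem Admissible.continuous_char (S : Admissible μ p ϖ ε χ) {f : K → K} (hf : Continuous f) :
    Continuous fun x => (χ (f x) : ℂ) :=
  continuous_subtype_val.comp (S.character.continuous.comp hf)

theorem char_eq_of_mul_sub (χ : AddChar K Circle) {x y : K} (h : χ (x - y) = 1) : χ x = χ y := by
  rw [← sub_add_cancel x y, AddChar.map_add_eq_mul, h, one_mul]

theorem Admissible.char_mul_eq_one (S : Admissible μ p ϖ ε χ) {n : ℤ} {x ξ : K}
    (hx : x ∈ fracIdeal ϖ n) (hξ : ξ ∈ fracIdeal ϖ (-n)) : χ (ξ * x) = 1 := by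
  refine S.character.trivial_on_integers _ ?_
  rw [norm_mul]
  rw [mem_fracIdeal] at hx hξ
  calc ‖ξ‖ * ‖x‖ ≤ ‖ϖ‖ ^ (-n) * ‖ϖ‖ ^ n := by gcongr
    _ = 1 := by rw [zpow_neg, inv_mul_cancel₀ (zpow_ne_zero _ S.prime.norm_pos.ne')]

theorem Admissible.integral_char_of_mem (S : Admissible μ p ϖ ε χ) {n : ℤ} {ξ : K}
    (hξ : ξ ∈ fracIdeal ϖ (-n)) :
    ∫ x in fracIdeal ϖ n, (χ (ξ * x) : ℂ) ∂μ = μ.real (fracIdeal ϖ n) := by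
  rw [setIntegral_congr_fun (g := fun _ => 1) (measurableSet_fracIdeal ϖ n)
    fun x hx => by simp [S.char_mul_eq_one hx hξ]]
  simp

theorem Admissible.integral_char_of_notMem (S : Admissible μ p ϖ ε χ) {n : ℤ} {ξ : K}
    (hξ : ξ ∉ fracIdeal ϖ (-n)) :
    ∫ x in fracIdeal ϖ n, (χ (ξ * x) : ℂ) ∂μ = 0 := by
  obtain ⟨y, hy, hy1⟩ := S.character.exists_ne_one S.prime
    (zpow_pos S.prime.norm_pos (-n)) (by simpa [mem_fracIdeal] using hξ) ⟨-n, rfl⟩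
  rw [zpow_neg, inv_inv] at hy
  have h : ∫ x in fracIdeal ϖ n, (χ (ξ * x) : ℂ) ∂μ =
      (χ (ξ * y) : ℂ) * ∫ x in fracIdeal ϖ n, (χ (ξ * x) : ℂ) ∂μ := by
    rw [← integral_indicator (measurableSet_fracIdeal ϖ n), ← integral_const_mul]
    conv_lhs => rw [← integral_add_right_eq_self _ y]
    refine integral_congr_ae (ae_of_all _ fun x => ?_)
    by_cases hx : x ∈ fracIdeal ϖ n
    · have hxy := (add_mem_fracIdeal_iff (mem_fracIdeal.mpr hy)).mpr hx
      simp only [Set.indicator_of_mem hx, Set.indicator_of_mem hxy, mul_add,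
        AddChar.map_add_eq_mul, Circle.coe_mul]
      ring
    · have hxy := mt (add_mem_fracIdeal_iff (mem_fracIdeal.mpr hy)).mp hx
      simp [Set.indicator_of_notMem hx, Set.indicator_of_notMem hxy]
  by_contra h0
  refine hy1 (Subtype.ext ?_)
  exact (mul_eq_right₀ h0).mp h.symm

theorem measureReal_fracIdeal_pos (hϖ : IsPrimeElement ϖ) (n : ℤ) :
    0 < μ.real (fracIdeal ϖ n) :=
  ENNReal.toReal_pos (Metric.measure_closedBall_pos μ 0 (zpow_pos hϖ.norm_pos n)).ne'
    (measure_fracIdeal_lt_top ϖ n).ne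

/-- An integrable function with vanishing Fourier transform is zero a.e. -/
theorem Admissible.ae_eq_zero_of_fourierIntegral_eq_zero (S : Admissible μ p ϖ ε χ) {g : K → ℂ}
    (hg : Integrable g μ) (h : ∀ ξ, ∫ x, g x * (χ (-(ξ * x)) : ℂ) ∂μ = 0) : g =ᵐ[μ] 0 := by
  refine ae_eq_zero_of_forall_setIntegral_closedBall S.prime hg.locallyIntegrable fun a n => ?_
  have hfin : IsFiniteMeasure (μ.restrict (fracIdeal ϖ (-n))) :=
    ⟨by simpa using measure_fracIdeal_lt_top ϖ (-n)⟩
  have hswap := integral_integral_swap (μ := μ) (ν := μ.restrict (fracIdeal ϖ (-n)))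
    (f := fun x ξ => g x * (χ (ξ * (a - x)) : ℂ)) (by
      have h1 : Integrable (fun z : K × K => g z.1) (μ.prod (μ.restrict (fracIdeal ϖ (-n)))) :=
        hg.comp_fst _
      refine h1.mul_bdd (c := 1) ?_ (ae_of_all _ fun z => by
        rw [Circle.norm_coe])
      exact Continuous.aestronglyMeasurable
        (continuous_subtype_val.comp (S.character.continuous.comp (by fun_prop))))
  have hR : ∀ ξ : K, ∫ x, g x * (χ (ξ * (a - x)) : ℂ) ∂μ = 0 := by
    intro ξ
    have : ∀ x, g x * (χ (ξ * (a - x)) : ℂ) = (χ (ξ * a) : ℂ) * (g x * (χ (-(ξ * x)) : ℂ)) := by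
      intro x
      rw [mul_sub, sub_eq_add_neg, AddChar.map_add_eq_mul, Circle.coe_mul]
      ring
    simp_rw [this]
    rw [integral_const_mul, h, mul_zero]
  simp_rw [hR, integral_const_mul, integral_zero] at hswap
  have hL : ∀ x, g x * ∫ ξ in fracIdeal ϖ (-n), (χ (ξ * (a - x)) : ℂ) ∂μ =
      (μ.real (fracIdeal ϖ (-n)) : ℂ) * (Metric.closedBall a (‖ϖ‖ ^ n)).indicator g x := by
    intro x
    simp_rw [mul_comm _ (a - x)]
    by_cases hx : x ∈ Metric.closedBall a (‖ϖ‖ ^ n)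
    · rw [S.integral_char_of_mem, Set.indicator_of_mem hx]
      · ring
      · rw [neg_neg, mem_fracIdeal, ← dist_eq_norm, dist_comm]
        exact hx
    · rw [S.integral_char_of_notMem, Set.indicator_of_notMem hx, mul_zero, mul_zero]
      · rw [neg_neg, mem_fracIdeal, ← dist_eq_norm, dist_comm]
        exact hx
  simp_rw [hL, integral_const_mul] at hswap
  rw [integral_indicator measurableSet_closedBall] at hswap
  refine (mul_eq_zero.mp hswap).resolve_left ?_
  exact_mod_cast (measureReal_fracIdeal_pos S.prime (-n)).ne'

/-- Haar measure on `𝒪`. -/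
noncomputable abbrev integersMeasure (μ : Measure K) : Measure K := μ.restrict (Metric.closedBall (0 : K) 1)

theorem Admissible.isProbabilityMeasure (S : Admissible μ p ϖ ε χ) :
    IsProbabilityMeasure (integersMeasure μ) :=
  ⟨by rw [Measure.restrict_apply_univ, S.measure_integers]⟩

theorem Admissible.memLp_char (S : Admissible μ p ϖ ε χ) (k : ℕ) :
    MemLp (fun x => (χ (-(u p ϖ ε k * x)) : ℂ)) 2 (integersMeasure μ) := by
  have := S.isProbabilityMeasure
  exact MemLp.of_bound (S.continuous_char (by fun_prop)).aestronglyMeasurable 1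
    (ae_of_all _ fun x => (Circle.norm_coe _).le)

/-- The functions `x ↦ χ(-u(k) x)` as elements of `L²(𝒪)`. -/
noncomputable def Admissible.charLp (S : Admissible μ p ϖ ε χ) (k : ℕ) :
    Lp ℂ 2 (integersMeasure μ) := (S.memLp_char k).toLp

theorem conj_char (χ : AddChar K Circle) (x : K) :
    (starRingEnd ℂ) (χ x : ℂ) = (χ (-x) : ℂ) := by
  rw [AddChar.map_neg_eq_inv, Circle.coe_inv_eq_conj]

theorem Admissible.inner_charLp (S : Admissible μ p ϖ ε χ) (k : ℕ)
    (f : Lp ℂ 2 (integersMeasure μ)) :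
    inner ℂ (S.charLp k) f = ∫ x in Metric.closedBall 0 1, f x * (χ (u p ϖ ε k * x) : ℂ) ∂μ := by
  rw [L2.inner_def]
  refine integral_congr_ae ?_
  filter_upwards [(S.memLp_char k).coeFn_toLp] with x hx
  rw [Admissible.charLp, hx, RCLike.inner_apply, conj_char, neg_neg]

theorem Admissible.orthonormal_charLp (S : Admissible μ p ϖ ε χ) : Orthonormal ℂ S.charLp := by
  rw [orthonormal_iff_ite]
  intro k l
  have h : inner ℂ (S.charLp k) (S.charLp l) =
      ∫ x in fracIdeal ϖ 0, (χ ((u p ϖ ε k - u p ϖ ε l) * x) : ℂ) ∂μ := by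
    rw [S.inner_charLp, fracIdeal_zero]
    refine integral_congr_ae ?_
    filter_upwards [(S.memLp_char l).coeFn_toLp] with x hx
    rw [Admissible.charLp, hx, sub_mul, sub_eq_add_neg, AddChar.map_add_eq_mul, Circle.coe_mul,
      mul_comm]
  rw [h]
  split_ifs with hkl
  · rw [hkl, sub_self, S.integral_char_of_mem (by simp [mem_fracIdeal]), fracIdeal_zero,
      Measure.real, S.measure_integers]
    simp
  · refine S.integral_char_of_notMem fun hmem => hkl ?_
    refine eq_of_norm_u_sub_le (p := p) S.prime S.basis ?_
    simpa [mem_fracIdeal] using hmem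

theorem Admissible.span_charLp_orthogonal (S : Admissible μ p ϖ ε χ) :
    (Submodule.span ℂ (Set.range S.charLp))ᗮ = ⊥ := by
  have := S.isProbabilityMeasure
  rw [Submodule.eq_bot_iff]
  intro f hf
  have hf' (k : ℕ) : ∫ x in Metric.closedBall 0 1, f x * (χ (u p ϖ ε k * x) : ℂ) ∂μ = 0 := by
    rw [← S.inner_charLp]
    exact hf _ (Submodule.subset_span ⟨k, rfl⟩)
  have hint : IntegrableOn f (Metric.closedBall (0 : K) 1) μ :=
    (Lp.memLp f).integrable one_le_two
  have h0 := S.ae_eq_zero_of_fourierIntegral_eq_zero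
    (g := (Metric.closedBall (0 : K) 1).indicator f)
    ((integrable_indicator_iff measurableSet_closedBall).mpr hint) fun ξ => by
      obtain ⟨k, hk⟩ := exists_norm_sub_u_le (p := p) S.prime S.basis (-ξ)
      rw [← hf' k, ← integral_indicator measurableSet_closedBall]
      refine integral_congr_ae (ae_of_all _ fun x => ?_)
      by_cases hx : x ∈ Metric.closedBall (0 : K) 1
      · simp only [Set.indicator_of_mem hx]
        congr 2
        refine char_eq_of_mul_sub χ ?_
        rw [← neg_mul, ← sub_mul]
        refine S.char_mul_eq_one (n := 0) (by simpa [mem_fracIdeal] using hx) ?_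
        simpa [mem_fracIdeal] using hk
      · simp [Set.indicator_of_notMem hx]
  rw [Lp.eq_zero_iff_ae_eq_zero]
  refine (ae_restrict_iff' measurableSet_closedBall).mpr ?_
  filter_upwards [h0] with x hx hxO
  rwa [Set.indicator_of_mem hxO] at hx

/-- The orthonormal basis `x ↦ χ(-u(k) x)`, `k ≥ 0`, of `L²(𝒪)`. -/
noncomputable def Admissible.charBasis (S : Admissible μ p ϖ ε χ) :
    HilbertBasis ℕ ℂ (Lp ℂ 2 (integersMeasure μ)) :=
  HilbertBasis.mkOfOrthogonalEqBot S.orthonormal_charLp S.span_charLp_orthogonal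

theorem Admissible.charBasis_apply (S : Admissible μ p ϖ ε χ) (k : ℕ) :
    S.charBasis k = S.charLp k := by
  simp [Admissible.charBasis]

theorem hasSum_norm_inner_sq {ι H : Type*} [NormedAddCommGroup H]
    [InnerProductSpace ℂ H] (b : HilbertBasis ι ℂ H) (x : H) :
    HasSum (fun k => ‖inner ℂ (b k) x‖ ^ 2) (‖x‖ ^ 2) := by
  have h := Complex.hasSum_re (b.hasSum_inner_mul_inner x x)
  rw [inner_self_eq_norm_sq_to_K] at h
  convert h using 1
  · funext k
    rw [← inner_conj_symm x (b k), ← Complex.normSq_eq_conj_mul_self, Complex.ofReal_re,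
      Complex.normSq_eq_norm_sq]
  · norm_cast

theorem norm_sq_eq_integral {α : Type*} [MeasurableSpace α] {ν : Measure α} (f : Lp ℂ 2 ν) :
    ‖f‖ ^ 2 = ∫ x, ‖f x‖ ^ 2 ∂ν := by
  have h := congrArg RCLike.re (inner_self_eq_norm_sq_to_K (𝕜 := ℂ) f)
  rw [L2.inner_def] at h
  simp_rw [inner_self_eq_norm_sq_to_K] at h
  have h2 : ∫ x, ((‖f x‖ : ℂ)) ^ 2 ∂ν = ((∫ x, ‖f x‖ ^ 2 ∂ν : ℝ) : ℂ) := by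
    rw [← integral_complex_ofReal]
    simp
  simp only [RCLike.ofReal_eq_complex_ofReal] at h
  rw [h2] at h
  norm_cast at h
  exact h.symm

/-- Parseval's identity on `𝒪`. -/
theorem Admissible.hasSum_fourierCoeff (S : Admissible μ p ϖ ε χ) {g : K → ℂ}
    (hg : MemLp g 2 (integersMeasure μ)) :
    HasSum (fun k => ‖∫ x in Metric.closedBall 0 1, g x * (χ (-(u p ϖ ε k * x)) : ℂ) ∂μ‖ ^ 2)
      (∫ x in Metric.closedBall 0 1, ‖g x‖ ^ 2 ∂μ) := by
  have hg' : MemLp (fun x => (starRingEnd ℂ) (g x)) 2 (integersMeasure μ) := hg.star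
  have h := hasSum_norm_inner_sq S.charBasis hg'.toLp
  convert h using 1
  · funext k
    congr 1
    rw [S.charBasis_apply, S.inner_charLp, ← RCLike.norm_conj, ← integral_conj]
    congr 1
    refine integral_congr_ae ?_
    filter_upwards [hg'.coeFn_toLp] with x hx
    rw [hx, map_mul, conj_char, neg_neg]
  · rw [norm_sq_eq_integral]
    refine integral_congr_ae ?_
    filter_upwards [hg'.coeFn_toLp] with x hx
    rw [hx, RCLike.norm_conj]

end IntegersParseval

section Plancherel

variable {K : Type*} [NontriviallyNormedField K] [IsUltrametricDist K] [ProperSpace K]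
  [MeasurableSpace K] [BorelSpace K] {μ : Measure K} [μ.IsAddHaarMeasure]
  {p : ℕ} [hp : Fact p.Prime] [CharP K p] {c : ℕ} [NeZero c] {ϖ : K} {ε : Fin c → K}
  {χ : AddChar K Circle}

theorem eLpNorm_two_eq_lintegral {α : Type*} [MeasurableSpace α] {ν : Measure α} (f : α → ℂ) :
    eLpNorm f 2 ν = (∫⁻ x, ‖f x‖ₑ ^ 2 ∂ν) ^ (1 / 2 : ℝ) := by
  rw [eLpNorm_eq_lintegral_rpow_enorm_toReal (by norm_num) (by norm_num)]
  simp

theorem lintegral_enorm_sq_lt_top {α : Type*} [MeasurableSpace α] {ν : Measure α} {f : α → ℂ}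
    (hf : MemLp f 2 ν) : ∫⁻ x, ‖f x‖ₑ ^ 2 ∂ν < ∞ := by
  have h := hf.2
  rw [eLpNorm_two_eq_lintegral] at h
  exact (ENNReal.rpow_lt_top_iff_of_pos (by norm_num)).mp h

theorem ofReal_integral_norm_sq {α : Type*} [MeasurableSpace α] {ν : Measure α} {f : α → ℂ}
    (hf : MemLp f 2 ν) : ENNReal.ofReal (∫ x, ‖f x‖ ^ 2 ∂ν) = ∫⁻ x, ‖f x‖ₑ ^ 2 ∂ν := by
  rw [ofReal_integral_eq_lintegral_ofReal ((memLp_two_iff_integrable_sq_norm hf.1).mp hf)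
    (ae_of_all _ fun x => by positivity)]
  refine lintegral_congr fun x => ?_
  rw [ENNReal.ofReal_pow (norm_nonneg _), ofReal_norm]

theorem ofReal_norm_sq_eq_lintegral {α : Type*} [MeasurableSpace α] {ν : Measure α}
    (f : Lp ℂ 2 ν) : ENNReal.ofReal (‖f‖ ^ 2) = ∫⁻ x, ‖f x‖ₑ ^ 2 ∂ν := by
  rw [norm_sq_eq_integral, ofReal_integral_norm_sq (Lp.memLp f)]

/-- The Fourier integral `∫ g(x) χ(-ξ x) dx`. -/
noncomputable def fourierIntegral (μ : Measure K) (χ : AddChar K Circle) (g : K → ℂ) (ξ : K) : ℂ :=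
  ∫ x, g x * (χ (-(ξ * x)) : ℂ) ∂μ

theorem truncatedFourier_eq (f : K → ℂ) (n : ℕ) :
    truncatedFourier μ χ f n = fourierIntegral μ χ ((Metric.closedBall 0 n).indicator f) := by
  funext ξ
  rw [truncatedFourier, fourierIntegral, ← integral_indicator measurableSet_closedBall]
  congr 1
  funext x
  by_cases hx : x ∈ Metric.closedBall (0 : K) n
  · simp only [Set.indicator_of_mem hx]
  · simp only [Set.indicator_of_notMem hx, zero_mul]

theorem fourierIntegral_congr_ae {f g : K → ℂ} (h : f =ᵐ[μ] g) :
    fourierIntegral μ χ f = fourierIntegral μ χ g := by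
  funext ξ
  refine integral_congr_ae ?_
  filter_upwards [h] with x hx
  rw [hx]

theorem Admissible.integrable_mul_char (S : Admissible μ p ϖ ε χ) {g : K → ℂ}
    (hg : Integrable g μ) (ξ : K) : Integrable (fun x => g x * (χ (-(ξ * x)) : ℂ)) μ := by
  refine hg.mul_bdd (c := 1) (S.continuous_char (by fun_prop)).aestronglyMeasurable
    (ae_of_all _ fun x => (Circle.norm_coe _).le)

theorem Admissible.fourierIntegral_add (S : Admissible μ p ϖ ε χ) {f g : K → ℂ}
    (hf : Integrable f μ) (hg : Integrable g μ) :
    fourierIntegral μ χ (f + g) = fourierIntegral μ χ f + fourierIntegral μ χ g := by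
  funext ξ
  simp only [fourierIntegral, Pi.add_apply, add_mul]
  exact integral_add (S.integrable_mul_char hf ξ) (S.integrable_mul_char hg ξ)

theorem fourierIntegral_const_smul (r : ℂ) (f : K → ℂ) :
    fourierIntegral μ χ (r • f) = r • fourierIntegral μ χ f := by
  funext ξ
  simp only [fourierIntegral, Pi.smul_apply, smul_eq_mul, mul_assoc]
  exact integral_const_mul _ _

theorem Admissible.fourierIntegral_sub (S : Admissible μ p ϖ ε χ) {f g : K → ℂ}
    (hf : Integrable f μ) (hg : Integrable g μ) :
    fourierIntegral μ χ (f - g) = fourierIntegral μ χ f - fourierIntegral μ χ g := by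
  funext ξ
  simp only [fourierIntegral, Pi.sub_apply, sub_mul]
  exact integral_sub (S.integrable_mul_char hf ξ) (S.integrable_mul_char hg ξ)

theorem Admissible.continuous_fourierIntegral (S : Admissible μ p ϖ ε χ) {g : K → ℂ}
    (hg : Integrable g μ) : Continuous (fourierIntegral μ χ g) := by
  refine continuous_of_dominated (bound := fun x => ‖g x‖)
    (fun ξ => (S.integrable_mul_char hg ξ).aestronglyMeasurable)
    (fun ξ => ae_of_all _ fun x => by rw [norm_mul, Circle.norm_coe, mul_one]) hg.norm
    (ae_of_all _ fun x => continuous_const.mul (S.continuous_char (by fun_prop)))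

theorem integrable_of_memLp_of_support {g : K → ℂ} (hg : MemLp g 2 μ) {R : ℝ}
    (hs : ∀ x ∉ Metric.closedBall (0 : K) R, g x = 0) : Integrable g μ := by
  have hfin : IsFiniteMeasure (μ.restrict (Metric.closedBall (0 : K) R)) :=
    ⟨by simpa using measure_closedBall_lt_top⟩
  have h : IntegrableOn g (Metric.closedBall (0 : K) R) μ :=
    (hg.restrict _).integrable one_le_two
  exact (integrableOn_iff_integrable_of_support_subset fun x hx => by
    by_contra h0
    exact hx (hs x h0)).mp h

theorem Admissible.lintegral_fourierIntegral_of_integers (S : Admissible μ p ϖ ε χ) {g : K → ℂ}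
    (hg : MemLp g 2 μ) (hs : ∀ x ∉ Metric.closedBall (0 : K) 1, g x = 0) :
    ∫⁻ ξ, ‖fourierIntegral μ χ g ξ‖ₑ ^ 2 ∂μ = ∫⁻ x, ‖g x‖ₑ ^ 2 ∂μ := by
  have hF (ξ : K) : fourierIntegral μ χ g ξ =
      ∫ x in Metric.closedBall 0 1, g x * (χ (-(ξ * x)) : ℂ) ∂μ := by
    rw [fourierIntegral, setIntegral_eq_integral_of_forall_compl_eq_zero]
    intro x hx
    rw [hs x hx, zero_mul]
  have hper (k : ℕ) (ξ : K) (hξ : ξ ∈ Metric.closedBall (0 : K) 1) :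
      fourierIntegral μ χ g (ξ + u p ϖ ε k) = fourierIntegral μ χ g (u p ϖ ε k) := by
    rw [hF, hF]
    refine setIntegral_congr_fun measurableSet_closedBall fun x hx => ?_
    congr 2
    refine char_eq_of_mul_sub χ ?_
    rw [← neg_mul, ← neg_mul, ← sub_mul]
    refine S.char_mul_eq_one (n := 0) (by simpa [mem_fracIdeal] using hx) ?_
    simpa [mem_fracIdeal] using hξ
  have h := S.hasSum_fourierCoeff (hg.restrict (Metric.closedBall (0 : K) 1))
  calc ∫⁻ ξ, ‖fourierIntegral μ χ g ξ‖ₑ ^ 2 ∂μ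
      = ∑' k, ∫⁻ ξ in Metric.closedBall (0 : K) 1, ‖fourierIntegral μ χ g (u p ϖ ε k)‖ₑ ^ 2 ∂μ := by
        rw [S.lintegral_eq_tsum_add]
        refine tsum_congr fun k => setLIntegral_congr_fun measurableSet_closedBall fun ξ hξ => ?_
        simp only [hper k ξ hξ]
    _ = ∑' k, ‖fourierIntegral μ χ g (u p ϖ ε k)‖ₑ ^ 2 := by
        simp only [setLIntegral_const, S.measure_integers, mul_one]
    _ = ENNReal.ofReal (∫ x in Metric.closedBall 0 1, ‖g x‖ ^ 2 ∂μ) := by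
        rw [← h.tsum_eq, ENNReal.ofReal_tsum_of_nonneg (fun _ => by positivity) h.summable]
        refine tsum_congr fun k => ?_
        rw [ENNReal.ofReal_pow (norm_nonneg _), ofReal_norm, hF]
    _ = ∫⁻ x, ‖g x‖ₑ ^ 2 ∂μ := by
        rw [ofReal_integral_norm_sq (hg.restrict _)]
        refine setLIntegral_eq_of_support_subset ?_
        intro x hx
        by_contra h0
        simp [hs x h0] at hx

theorem Admissible.memLp_comp_zpow_mul (S : Admissible μ p ϖ ε χ) {g : K → ℂ} (hg : MemLp g 2 μ)
    (n : ℤ) : MemLp (fun x => g (ϖ ^ n * x)) 2 μ := by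
  refine ⟨hg.1.comp_quasiMeasurePreserving (S.quasiMeasurePreserving n), ?_⟩
  rw [eLpNorm_two_eq_lintegral, S.lintegral_zpow_mul n fun x => ‖g x‖ₑ ^ 2]
  refine ENNReal.rpow_lt_top_of_nonneg (by norm_num) (ENNReal.mul_ne_top ?_ ?_)
  · exact ENNReal.zpow_ne_top (cardResidue_ne_zero p c) (ENNReal.natCast_ne_top _) n
  · exact (lintegral_enorm_sq_lt_top hg).ne

theorem Admissible.fourierIntegral_comp_zpow_mul (S : Admissible μ p ϖ ε χ) (g : K → ℂ) (n : ℤ)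
    (ξ : K) : fourierIntegral μ χ (fun x => g (ϖ ^ n * x)) ξ =
      (((p ^ c : ℕ) : ℝ) ^ n : ℝ) • fourierIntegral μ χ g (ϖ ^ (-n) * ξ) := by
  rw [fourierIntegral, fourierIntegral, ← S.integral_zpow_mul]
  congr 1
  funext x
  congr 4
  rw [zpow_neg]
  field_simp [zpow_ne_zero n S.prime.ne_zero]

/-- Plancherel's identity for functions supported in a ball. -/
theorem Admissible.lintegral_fourierIntegral (S : Admissible μ p ϖ ε χ) {g : K → ℂ}
    (hg : MemLp g 2 μ) {R : ℝ} (hs : ∀ x ∉ Metric.closedBall (0 : K) R, g x = 0) :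
    ∫⁻ ξ, ‖fourierIntegral μ χ g ξ‖ₑ ^ 2 ∂μ = ∫⁻ x, ‖g x‖ₑ ^ 2 ∂μ := by
  obtain ⟨n, hn⟩ := exists_closedBall_subset_fracIdeal S.prime R
  have hq0 := cardResidue_ne_zero p c
  have hqt : ((p ^ c : ℕ) : ℝ≥0∞) ≠ ∞ := ENNReal.natCast_ne_top _
  have hqr : (0 : ℝ) < ((p ^ c : ℕ) : ℝ) := by exact_mod_cast pow_pos hp.out.pos c
  have h := S.lintegral_fourierIntegral_of_integers (S.memLp_comp_zpow_mul hg (-(n : ℤ))) (by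
    intro x hx
    refine hs _ fun hmem => hx ?_
    have h1 := hn hmem
    rw [zpow_mul_mem_fracIdeal S.prime, sub_self, fracIdeal_zero] at h1
    exact h1)
  rw [S.lintegral_zpow_mul (-(n : ℤ)) fun x => ‖g x‖ₑ ^ 2] at h
  simp_rw [S.fourierIntegral_comp_zpow_mul g, enorm_smul, mul_pow] at h
  rw [lintegral_const_mul' _ _ (by simp),
    S.lintegral_zpow_mul (- -(n : ℤ)) fun ξ => ‖fourierIntegral μ χ g ξ‖ₑ ^ 2,
    ← mul_assoc] at h
  have he : ‖(((p ^ c : ℕ) : ℝ) ^ (-(n : ℤ)) : ℝ)‖ₑ = ((p ^ c : ℕ) : ℝ≥0∞) ^ (-(n : ℤ)) := by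
    rw [Real.enorm_eq_ofReal (by positivity), zpow_neg, zpow_natCast,
      ENNReal.ofReal_inv_of_pos (by positivity), ENNReal.ofReal_pow (by positivity),
      ENNReal.ofReal_natCast, ENNReal.zpow_neg, zpow_natCast]
  rw [he, sq, mul_assoc (((p ^ c : ℕ) : ℝ≥0∞) ^ (-(n : ℤ))), ← ENNReal.zpow_add hq0 hqt,
    add_neg_cancel, zpow_zero, mul_one] at h
  exact (ENNReal.mul_right_inj (ENNReal.zpow_pos hq0 hqt _).ne'
    (ENNReal.zpow_ne_top hq0 hqt _)).mp h

theorem Admissible.eLpNorm_fourierIntegral (S : Admissible μ p ϖ ε χ) {g : K → ℂ}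
    (hg : MemLp g 2 μ) {R : ℝ} (hs : ∀ x ∉ Metric.closedBall (0 : K) R, g x = 0) :
    eLpNorm (fourierIntegral μ χ g) 2 μ = eLpNorm g 2 μ := by
  rw [eLpNorm_two_eq_lintegral, eLpNorm_two_eq_lintegral, S.lintegral_fourierIntegral hg hs]

theorem Admissible.memLp_fourierIntegral (S : Admissible μ p ϖ ε χ) {g : K → ℂ}
    (hg : MemLp g 2 μ) {R : ℝ} (hs : ∀ x ∉ Metric.closedBall (0 : K) R, g x = 0) :
    MemLp (fourierIntegral μ χ g) 2 μ :=
  ⟨(S.continuous_fourierIntegral (integrable_of_memLp_of_support hg hs)).aestronglyMeasurable,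
    by rw [S.eLpNorm_fourierIntegral hg hs]; exact hg.2⟩

/-- The truncation of `f ∈ L²(K)` to the ball of radius `n`. -/
noncomputable def truncLp (f : Lp ℂ 2 μ) (n : ℕ) : Lp ℂ 2 μ :=
  ((Lp.memLp f).indicator (s := Metric.closedBall (0 : K) n) measurableSet_closedBall).toLp

theorem coeFn_truncLp (f : Lp ℂ 2 μ) (n : ℕ) :
    truncLp f n =ᵐ[μ] (Metric.closedBall (0 : K) n).indicator f := MemLp.coeFn_toLp _

theorem tendsto_truncLp (f : Lp ℂ 2 μ) : Tendsto (truncLp f) atTop (𝓝 f) := by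
  rw [Lp.tendsto_Lp_iff_tendsto_eLpNorm']
  have h (n : ℕ) : eLpNorm (truncLp f n - f : K → ℂ) 2 μ =
      (∫⁻ x, ‖(Metric.closedBall (0 : K) n).indicator f x - f x‖ₑ ^ 2 ∂μ) ^ (1 / 2 : ℝ) := by
    rw [← eLpNorm_two_eq_lintegral]
    refine eLpNorm_congr_ae ?_
    filter_upwards [coeFn_truncLp f n] with x hx
    rw [Pi.sub_apply, hx]
  simp_rw [h]
  have h0 : Tendsto (fun n : ℕ =>
      ∫⁻ x, ‖(Metric.closedBall (0 : K) n).indicator f x - f x‖ₑ ^ 2 ∂μ) atTop (𝓝 0) := by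
    rw [← lintegral_zero (μ := μ)]
    refine tendsto_lintegral_of_dominated_convergence' (fun x => ‖f x‖ₑ ^ 2) (fun n => ?_)
      (fun n => ae_of_all _ fun x => ?_) (lintegral_enorm_sq_lt_top (Lp.memLp f)).ne
      (ae_of_all _ fun x => ?_)
    · exact ((((Lp.memLp f).indicator measurableSet_closedBall).sub
        (Lp.memLp f)).aestronglyMeasurable.enorm).pow_const 2
    · by_cases hx : x ∈ Metric.closedBall (0 : K) n
      · simp [Set.indicator_of_mem hx]
      · simp [Set.indicator_of_notMem hx]
    · obtain ⟨N, hN⟩ := exists_nat_ge ‖x‖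
      refine tendsto_const_nhds.congr' ?_
      filter_upwards [eventually_ge_atTop N] with n hn
      have hx : x ∈ Metric.closedBall (0 : K) n := by
        rw [mem_closedBall_zero_iff]
        exact hN.trans (by exact_mod_cast hn)
      simp [Set.indicator_of_mem hx]
  simpa using h0.ennrpow_const (1 / 2 : ℝ)

theorem indicator_closedBall_eq_zero (f : K → ℂ) (R : ℝ) :
    ∀ x ∉ Metric.closedBall (0 : K) R, (Metric.closedBall (0 : K) R).indicator f x = 0 :=
  fun _ hx => Set.indicator_of_notMem hx f

theorem memLp_indicator_closedBall (f : Lp ℂ 2 μ) (R : ℝ) :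
    MemLp ((Metric.closedBall (0 : K) R).indicator f) 2 μ :=
  (Lp.memLp f).indicator measurableSet_closedBall

theorem Admissible.memLp_truncatedFourier (S : Admissible μ p ϖ ε χ) (f : Lp ℂ 2 μ) (n : ℕ) :
    MemLp (truncatedFourier μ χ f n) 2 μ := by
  rw [truncatedFourier_eq]
  exact S.memLp_fourierIntegral (memLp_indicator_closedBall f n) (indicator_closedBall_eq_zero _ _)

/-- The truncated Fourier integrals as elements of `L²(K)`. -/
noncomputable def Admissible.truncFourierLp (S : Admissible μ p ϖ ε χ) (f : Lp ℂ 2 μ) (n : ℕ) :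
    Lp ℂ 2 μ := (S.memLp_truncatedFourier f n).toLp

theorem Admissible.coeFn_truncFourierLp (S : Admissible μ p ϖ ε χ) (f : Lp ℂ 2 μ) (n : ℕ) :
    S.truncFourierLp f n =ᵐ[μ] fourierIntegral μ χ ((Metric.closedBall 0 n).indicator f) := by
  rw [← truncatedFourier_eq]
  exact MemLp.coeFn_toLp _

theorem Admissible.dist_truncFourierLp (S : Admissible μ p ϖ ε χ) (f : Lp ℂ 2 μ) (n m : ℕ) :
    dist (S.truncFourierLp f n) (S.truncFourierLp f m) = dist (truncLp f n) (truncLp f m) := by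
  have hn := memLp_indicator_closedBall f n
  have hm := memLp_indicator_closedBall f m
  have hs (a : ℕ) (ha : a ≤ max n m) (x : K) (hx : x ∉ Metric.closedBall (0 : K) (max n m : ℕ)) :
      (Metric.closedBall (0 : K) a).indicator f x = 0 :=
    Set.indicator_of_notMem (fun h => hx (Metric.closedBall_subset_closedBall
      (by exact_mod_cast ha) h)) f
  rw [Lp.dist_def, Lp.dist_def]
  congr 1
  have h1 : eLpNorm (truncLp f n - truncLp f m : K → ℂ) 2 μ =
      eLpNorm ((Metric.closedBall (0 : K) n).indicator f -
        (Metric.closedBall (0 : K) m).indicator f) 2 μ :=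
    eLpNorm_congr_ae ((coeFn_truncLp f n).sub (coeFn_truncLp f m))
  rw [h1, ← S.eLpNorm_fourierIntegral (R := (max n m : ℕ)) (hn.sub hm) (fun x hx => by
    rw [Pi.sub_apply, hs n (le_max_left _ _) x hx, hs m (le_max_right _ _) x hx, sub_zero]),
    S.fourierIntegral_sub
      (integrable_of_memLp_of_support hn (indicator_closedBall_eq_zero _ _))
      (integrable_of_memLp_of_support hm (indicator_closedBall_eq_zero _ _))]
  exact eLpNorm_congr_ae ((S.coeFn_truncFourierLp f n).sub (S.coeFn_truncFourierLp f m))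

theorem Admissible.norm_truncFourierLp (S : Admissible μ p ϖ ε χ) (f : Lp ℂ 2 μ) (n : ℕ) :
    ‖S.truncFourierLp f n‖ = ‖truncLp f n‖ := by
  rw [Admissible.truncFourierLp, truncLp, Lp.norm_toLp, Lp.norm_toLp, truncatedFourier_eq,
    S.eLpNorm_fourierIntegral (memLp_indicator_closedBall f n) (indicator_closedBall_eq_zero _ _)]

theorem Admissible.isFourierTransform_iff (S : Admissible μ p ϖ ε χ) (f g : Lp ℂ 2 μ) :
    IsFourierTransform μ χ f g ↔ Tendsto (S.truncFourierLp f) atTop (𝓝 g) := by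
  rw [Lp.tendsto_Lp_iff_tendsto_eLpNorm', IsFourierTransform]
  refine tendsto_congr fun n => eLpNorm_congr_ae ?_
  filter_upwards [(S.memLp_truncatedFourier f n).coeFn_toLp] with x hx
  rw [Pi.sub_apply, Admissible.truncFourierLp, hx]

theorem Admissible.tendsto_fourier (S : Admissible μ p ϖ ε χ) (f : Lp ℂ 2 μ) :
    Tendsto (S.truncFourierLp f) atTop (𝓝 (fourier μ χ f)) := by
  have hex : ∃ g : Lp ℂ 2 μ, IsFourierTransform μ χ f g := by
    have hc : CauchySeq (S.truncFourierLp f) := by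
      have h := (tendsto_truncLp f).cauchySeq
      rw [Metric.cauchySeq_iff] at h ⊢
      simpa only [S.dist_truncFourierLp] using h
    obtain ⟨g, hg⟩ := cauchySeq_tendsto_of_complete hc
    exact ⟨g, (S.isFourierTransform_iff f g).mpr hg⟩
  rw [← S.isFourierTransform_iff, fourier, dif_pos hex]
  exact hex.choose_spec

theorem Admissible.truncFourierLp_add (S : Admissible μ p ϖ ε χ) (f g : Lp ℂ 2 μ) (n : ℕ) :
    S.truncFourierLp (f + g) n = S.truncFourierLp f n + S.truncFourierLp g n := by
  have hi (f : Lp ℂ 2 μ) := integrable_of_memLp_of_support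
    (memLp_indicator_closedBall f n) (indicator_closedBall_eq_zero _ _)
  refine Lp.ext ?_
  have h : (Metric.closedBall (0 : K) n).indicator (f + g : Lp ℂ 2 μ) =ᵐ[μ]
      (Metric.closedBall (0 : K) n).indicator f + (Metric.closedBall (0 : K) n).indicator g := by
    rw [← Set.indicator_add']
    filter_upwards [Lp.coeFn_add f g] with x hx
    simp only [Set.indicator, hx]
  have h' := S.coeFn_truncFourierLp (f + g) n
  rw [fourierIntegral_congr_ae h, S.fourierIntegral_add (hi f) (hi g)] at h'
  filter_upwards [h', S.coeFn_truncFourierLp f n, S.coeFn_truncFourierLp g n,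
    Lp.coeFn_add (S.truncFourierLp f n) (S.truncFourierLp g n)] with x h1 h2 h3 h4
  rw [h1, h4, Pi.add_apply, Pi.add_apply, h2, h3]

theorem Admissible.truncFourierLp_smul (S : Admissible μ p ϖ ε χ) (r : ℂ) (f : Lp ℂ 2 μ) (n : ℕ) :
    S.truncFourierLp (r • f) n = r • S.truncFourierLp f n := by
  refine Lp.ext ?_
  have h : (Metric.closedBall (0 : K) n).indicator (r • f : Lp ℂ 2 μ) =ᵐ[μ]
      r • (Metric.closedBall (0 : K) n).indicator f := by
    filter_upwards [Lp.coeFn_smul r f] with x hx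
    by_cases h : x ∈ Metric.closedBall (0 : K) n
    · rw [Pi.smul_apply, Set.indicator_of_mem h, Set.indicator_of_mem h, hx, Pi.smul_apply]
    · rw [Pi.smul_apply, Set.indicator_of_notMem h, Set.indicator_of_notMem h, smul_zero]
  have h' := S.coeFn_truncFourierLp (r • f) n
  rw [fourierIntegral_congr_ae h, fourierIntegral_const_smul] at h'
  filter_upwards [h', S.coeFn_truncFourierLp f n,
    Lp.coeFn_smul r (S.truncFourierLp f n)] with x h1 h2 h4
  rw [h1, h4, Pi.smul_apply, Pi.smul_apply, h2]

/-- The Fourier transform as a linear isometry of `L²(K)`. -/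
noncomputable def Admissible.fourierIsometry (S : Admissible μ p ϖ ε χ) :
    Lp ℂ 2 μ →ₗᵢ[ℂ] Lp ℂ 2 μ where
  toFun := fourier μ χ
  map_add' f g := by
    refine tendsto_nhds_unique (S.tendsto_fourier (f + g)) ?_
    simp_rw [funext (S.truncFourierLp_add f g)]
    exact (S.tendsto_fourier f).add (S.tendsto_fourier g)
  map_smul' r f := by
    refine tendsto_nhds_unique (S.tendsto_fourier (r • f)) ?_
    rw [funext (S.truncFourierLp_smul r f)]
    exact (S.tendsto_fourier f).const_smul r
  norm_map' f := by
    refine tendsto_nhds_unique (S.tendsto_fourier f).norm ?_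
    simp_rw [S.norm_truncFourierLp]
    exact (tendsto_truncLp f).norm

theorem Admissible.fourier_coeFn_of_support (S : Admissible μ p ϖ ε χ) (f : Lp ℂ 2 μ) {R : ℝ}
    (hs : ∀ᵐ x ∂μ, x ∉ Metric.closedBall (0 : K) R → f x = 0) :
    fourier μ χ f =ᵐ[μ] fourierIntegral μ χ f := by
  obtain ⟨N, hN⟩ := exists_nat_ge R
  have h (n : ℕ) (hn : N ≤ n) : (Metric.closedBall (0 : K) n).indicator f =ᵐ[μ] f := by
    filter_upwards [hs] with x hx
    by_cases hxn : x ∈ Metric.closedBall (0 : K) n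
    · rw [Set.indicator_of_mem hxn]
    · rw [Set.indicator_of_notMem hxn, hx fun hxR => hxn
        (Metric.closedBall_subset_closedBall (hN.trans (by exact_mod_cast hn)) hxR)]
  have hconst (n : ℕ) (hn : N ≤ n) : S.truncFourierLp f N = S.truncFourierLp f n := by
    refine Lp.ext ?_
    have h1 := S.coeFn_truncFourierLp f N
    have h2 := S.coeFn_truncFourierLp f n
    rw [fourierIntegral_congr_ae (h _ le_rfl)] at h1
    rw [fourierIntegral_congr_ae (h n hn)] at h2
    exact h1.trans h2.symm
  have hlim : fourier μ χ f = S.truncFourierLp f N := by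
    refine tendsto_nhds_unique (S.tendsto_fourier f) (tendsto_const_nhds.congr' ?_)
    filter_upwards [eventually_ge_atTop N] with n hn using hconst n hn
  have h1 := S.coeFn_truncFourierLp f N
  rw [fourierIntegral_congr_ae (h _ le_rfl)] at h1
  rwa [hlim]

/-- Continuous maps on `L²(K)` that agree on functions supported in balls are equal. -/
theorem eq_of_eq_on_bounded_support {A B : Lp ℂ 2 μ → Lp ℂ 2 μ} (hA : Continuous A)
    (hB : Continuous B)
    (h : ∀ (f : Lp ℂ 2 μ) (R : ℝ), (∀ᵐ x ∂μ, x ∉ Metric.closedBall (0 : K) R → f x = 0) →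
      A f = B f) (f : Lp ℂ 2 μ) : A f = B f := by
  refine tendsto_nhds_unique ((hA.tendsto f).comp (tendsto_truncLp f)) ?_
  refine ((hB.tendsto f).comp (tendsto_truncLp f)).congr fun n => (h _ n ?_).symm
  filter_upwards [coeFn_truncLp f n] with x hx hxn
  rw [hx, Set.indicator_of_notMem hxn]

end Plancherel

section Operators

variable {K : Type*} [NontriviallyNormedField K] [IsUltrametricDist K] [ProperSpace K]
  [MeasurableSpace K] [BorelSpace K] {μ : Measure K} [μ.IsAddHaarMeasure]
  {p : ℕ} [hp : Fact p.Prime] [CharP K p] {c : ℕ} [NeZero c] {ϖ : K} {ε : Fin c → K}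
  {χ : AddChar K Circle}

theorem coeFn_translate (a : K) (f : Lp ℂ 2 μ) :
    translate μ a f =ᵐ[μ] fun x => f (x - a) :=
  Lp.coeFn_compMeasurePreserving f (measurePreserving_sub_right μ a)

/-- Translation as a linear isometry of `L²(K)`. -/
noncomputable def translateIsometry (μ : Measure K) [μ.IsAddHaarMeasure] (a : K) :
    Lp ℂ 2 μ →ₗᵢ[ℂ] Lp ℂ 2 μ :=
  Lp.compMeasurePreservingₗᵢ ℂ (fun x => x - a) (measurePreserving_sub_right μ a)

theorem translate_translate (a b : K) (f : Lp ℂ 2 μ) :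
    translate μ a (translate μ b f) = translate μ (a + b) f := by
  refine Lp.ext ?_
  have h := (measurePreserving_sub_right μ a).quasiMeasurePreserving.ae (coeFn_translate b f)
  filter_upwards [coeFn_translate a (translate μ b f), coeFn_translate (a + b) f, h]
    with x h1 h2 h3
  rw [h1, h2, h3, sub_sub]

theorem translate_zero (f : Lp ℂ 2 μ) : translate μ 0 f = f := by
  refine Lp.ext ?_
  filter_upwards [coeFn_translate 0 f] with x h1
  rw [h1, sub_zero]

theorem coeFn_dilate (q : ℕ) (hϖ : ϖ ≠ 0) (j : ℤ) (f : Lp ℂ 2 μ) :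
    dilate μ q hϖ j f =ᵐ[μ]
      fun x => (((q : ℝ) ^ ((j : ℝ) / 2) : ℝ) : ℂ) * f (ϖ ^ (-j) * x) :=
  MemLp.coeFn_toLp _

theorem card_pos (p c : ℕ) [hp : Fact p.Prime] : (0 : ℝ) < ((p ^ c : ℕ) : ℝ) := by
  exact_mod_cast pow_pos hp.out.pos c

theorem Admissible.dilate_dilate (S : Admissible μ p ϖ ε χ) (i j : ℤ) (f : Lp ℂ 2 μ) :
    dilate μ (p ^ c) S.prime.ne_zero i (dilate μ (p ^ c) S.prime.ne_zero j f) =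
      dilate μ (p ^ c) S.prime.ne_zero (i + j) f := by
  refine Lp.ext ?_
  have h := (S.quasiMeasurePreserving (-i)).ae (coeFn_dilate (p ^ c) S.prime.ne_zero j f)
  filter_upwards [coeFn_dilate (p ^ c) S.prime.ne_zero i (dilate μ (p ^ c) S.prime.ne_zero j f),
    coeFn_dilate (p ^ c) S.prime.ne_zero (i + j) f, h] with x h1 h2 h3
  rw [h1, h2, h3, ← mul_assoc, ← mul_assoc, ← Complex.ofReal_mul, ← Real.rpow_add (card_pos p c),
    ← zpow_add₀ S.prime.ne_zero]
  push_cast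
  ring_nf

theorem dilate_zero (q : ℕ) (hϖ : ϖ ≠ 0) (f : Lp ℂ 2 μ) : dilate μ q hϖ 0 f = f := by
  refine Lp.ext ?_
  filter_upwards [coeFn_dilate q hϖ 0 f] with x h1
  rw [h1]
  simp

theorem Admissible.norm_dilate (S : Admissible μ p ϖ ε χ) (j : ℤ) (f : Lp ℂ 2 μ) :
    ‖dilate μ (p ^ c) S.prime.ne_zero j f‖ = ‖f‖ := by
  have hq0 := cardResidue_ne_zero p c
  have hqt : ((p ^ c : ℕ) : ℝ≥0∞) ≠ ∞ := ENNReal.natCast_ne_top _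
  rw [dilate, Lp.norm_toLp, Lp.norm_def, eLpNorm_two_eq_lintegral, eLpNorm_two_eq_lintegral]
  congr 2
  simp_rw [enorm_mul, mul_pow]
  rw [lintegral_const_mul' _ _ (by simp), S.lintegral_zpow_mul (-j) fun x => ‖f x‖ₑ ^ 2,
    ← mul_assoc]
  have he : ‖(((((p ^ c : ℕ) : ℝ) ^ ((j : ℝ) / 2) : ℝ)) : ℂ)‖ₑ ^ 2 = ((p ^ c : ℕ) : ℝ≥0∞) ^ j := by
    rw [← ofReal_norm, Complex.norm_real, ← ENNReal.ofReal_pow (norm_nonneg _),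
      Real.norm_of_nonneg (Real.rpow_nonneg (card_pos p c).le _), ← Real.rpow_natCast,
      ← Real.rpow_mul (card_pos p c).le]
    have : (j : ℝ) / 2 * (2 : ℕ) = j := by push_cast; ring
    rw [this, ← ENNReal.ofReal_rpow_of_pos (card_pos p c), ENNReal.ofReal_natCast,
      ENNReal.rpow_intCast]
  rw [he, ← ENNReal.zpow_add hq0 hqt, add_neg_cancel, zpow_zero, one_mul]

/-- The dilation `D^j` as a unitary operator of `L²(K)`. -/
noncomputable def Admissible.dilateEquiv (S : Admissible μ p ϖ ε χ) (j : ℤ) :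
    Lp ℂ 2 μ ≃ₗᵢ[ℂ] Lp ℂ 2 μ where
  toFun := dilate μ (p ^ c) S.prime.ne_zero j
  invFun := dilate μ (p ^ c) S.prime.ne_zero (-j)
  left_inv f := by rw [S.dilate_dilate, neg_add_cancel, dilate_zero]
  right_inv f := by rw [S.dilate_dilate, add_neg_cancel, dilate_zero]
  map_add' f g := by
    refine Lp.ext ?_
    filter_upwards [coeFn_dilate (p ^ c) S.prime.ne_zero j (f + g),
      coeFn_dilate (p ^ c) S.prime.ne_zero j f, coeFn_dilate (p ^ c) S.prime.ne_zero j g,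
      Lp.coeFn_add (dilate μ (p ^ c) S.prime.ne_zero j f) (dilate μ (p ^ c) S.prime.ne_zero j g),
      (S.quasiMeasurePreserving (-j)).ae (Lp.coeFn_add f g)] with x h1 h2 h3 h4 h5
    rw [h1, h4, Pi.add_apply, h2, h3, h5, Pi.add_apply, mul_add]
  map_smul' r f := by
    refine Lp.ext ?_
    filter_upwards [coeFn_dilate (p ^ c) S.prime.ne_zero j (r • f),
      coeFn_dilate (p ^ c) S.prime.ne_zero j f,
      Lp.coeFn_smul r (dilate μ (p ^ c) S.prime.ne_zero j f),
      (S.quasiMeasurePreserving (-j)).ae (Lp.coeFn_smul r f)] with x h1 h2 h4 h5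
    rw [h1, RingHom.id_apply, h4, Pi.smul_apply, h2, h5, Pi.smul_apply, smul_eq_mul, smul_eq_mul]
    ring
  norm_map' f := S.norm_dilate j f

theorem Admissible.coeFn_dilateEquiv (S : Admissible μ p ϖ ε χ) (j : ℤ) (f : Lp ℂ 2 μ) :
    S.dilateEquiv j f =ᵐ[μ]
      fun x => ((((p ^ c : ℕ) : ℝ) ^ ((j : ℝ) / 2) : ℝ) : ℂ) * f (ϖ ^ (-j) * x) :=
  coeFn_dilate _ S.prime.ne_zero _ _

theorem Admissible.dilateEquiv_dilateEquiv (S : Admissible μ p ϖ ε χ) (i j : ℤ) (f : Lp ℂ 2 μ) :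
    S.dilateEquiv i (S.dilateEquiv j f) = S.dilateEquiv (i + j) f :=
  S.dilate_dilate i j f

theorem Admissible.dilateEquiv_zero (S : Admissible μ p ϖ ε χ) (f : Lp ℂ 2 μ) :
    S.dilateEquiv 0 f = f :=
  dilate_zero _ S.prime.ne_zero f

theorem Admissible.dilateEquiv_translate (S : Admissible μ p ϖ ε χ) (j : ℤ) (a : K)
    (f : Lp ℂ 2 μ) :
    S.dilateEquiv j (translate μ a f) = translate μ (ϖ ^ j * a) (S.dilateEquiv j f) := by
  refine Lp.ext ?_
  filter_upwards [S.coeFn_dilateEquiv j (translate μ a f),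
    coeFn_translate (ϖ ^ j * a) (S.dilateEquiv j f),
    (S.quasiMeasurePreserving (-j)).ae (coeFn_translate a f),
    (measurePreserving_sub_right μ (ϖ ^ j * a)).quasiMeasurePreserving.ae
      (S.coeFn_dilateEquiv j f)] with x h1 h2 h3 h4
  rw [h1, h2, h3, h4, mul_sub, ← mul_assoc (ϖ ^ (-j)), ← zpow_add₀ S.prime.ne_zero, neg_add_cancel,
    zpow_zero, one_mul]

theorem Admissible.memLp_modulate (S : Admissible μ p ϖ ε χ) (a : K) (f : Lp ℂ 2 μ) :
    MemLp (fun x => (χ (-(x * a)) : ℂ) * f x) 2 μ := by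
  refine (Lp.memLp f).of_le ((S.continuous_char (by fun_prop)).aestronglyMeasurable.mul
    (Lp.aestronglyMeasurable f)) (ae_of_all _ fun x => ?_)
  rw [norm_mul, Circle.norm_coe, one_mul]

/-- Multiplication by the character `ξ ↦ χ(-ξ a)` as a linear isometry of `L²(K)`. -/
noncomputable def Admissible.modulate (S : Admissible μ p ϖ ε χ) (a : K) :
    Lp ℂ 2 μ →ₗᵢ[ℂ] Lp ℂ 2 μ where
  toFun f := (S.memLp_modulate a f).toLp
  map_add' f g := by
    refine Lp.ext ?_
    filter_upwards [(S.memLp_modulate a (f + g)).coeFn_toLp, (S.memLp_modulate a f).coeFn_toLp,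
      (S.memLp_modulate a g).coeFn_toLp, Lp.coeFn_add f g,
      Lp.coeFn_add (S.memLp_modulate a f).toLp (S.memLp_modulate a g).toLp] with x h1 h2 h3 h4 h5
    rw [h1, h5, Pi.add_apply, h2, h3, h4, Pi.add_apply, mul_add]
  map_smul' r f := by
    refine Lp.ext ?_
    filter_upwards [(S.memLp_modulate a (r • f)).coeFn_toLp, (S.memLp_modulate a f).coeFn_toLp,
      Lp.coeFn_smul r f, Lp.coeFn_smul r (S.memLp_modulate a f).toLp] with x h1 h2 h4 h5
    rw [h1, RingHom.id_apply, h5, Pi.smul_apply, h2, h4, Pi.smul_apply, smul_eq_mul, smul_eq_mul]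
    ring
  norm_map' f := by
    change ‖(S.memLp_modulate a f).toLp‖ = ‖f‖
    rw [Lp.norm_toLp, Lp.norm_def]
    congr 1
    refine eLpNorm_congr_norm_ae (ae_of_all _ fun x => ?_)
    rw [norm_mul, Circle.norm_coe, one_mul]

theorem Admissible.coeFn_modulate (S : Admissible μ p ϖ ε χ) (a : K) (f : Lp ℂ 2 μ) :
    S.modulate a f =ᵐ[μ] fun x => (χ (-(x * a)) : ℂ) * f x :=
  (S.memLp_modulate a f).coeFn_toLp

theorem Admissible.fourierIsometry_translate (S : Admissible μ p ϖ ε χ) (a : K) (f : Lp ℂ 2 μ) :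
    S.fourierIsometry (translate μ a f) = S.modulate a (S.fourierIsometry f) := by
  refine eq_of_eq_on_bounded_support (A := fun f => S.fourierIsometry (translate μ a f))
    (B := fun f => S.modulate a (S.fourierIsometry f))
    (S.fourierIsometry.continuous.comp (translateIsometry μ a).continuous)
    ((S.modulate a).continuous.comp S.fourierIsometry.continuous) (fun f R hf => ?_) f
  have hs : ∀ᵐ x ∂μ, x ∉ Metric.closedBall (0 : K) (R + ‖a‖) → translate μ a f x = 0 := by
    filter_upwards [coeFn_translate a f,
      (measurePreserving_sub_right μ a).quasiMeasurePreserving.ae hf] with x h1 h2 hx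
    rw [h1]
    refine h2 fun h => hx ?_
    rw [mem_closedBall_zero_iff] at h ⊢
    calc ‖x‖ = ‖(x - a) + a‖ := by rw [sub_add_cancel]
      _ ≤ ‖x - a‖ + ‖a‖ := norm_add_le _ _
      _ ≤ R + ‖a‖ := by gcongr
  refine Lp.ext ?_
  have h1 : S.fourierIsometry (translate μ a f) =ᵐ[μ] fourierIntegral μ χ (translate μ a f) :=
    S.fourier_coeFn_of_support _ hs
  have h2 : S.fourierIsometry f =ᵐ[μ] fourierIntegral μ χ f := S.fourier_coeFn_of_support _ hf
  filter_upwards [h1, h2, S.coeFn_modulate a (S.fourierIsometry f)] with ξ h1 h2 h3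
  rw [h1, h3, h2, fourierIntegral_congr_ae (coeFn_translate a f), fourierIntegral, fourierIntegral,
    ← integral_const_mul, ← integral_add_right_eq_self _ a]
  congr 1
  funext x
  rw [add_sub_cancel_right, mul_add, neg_add, AddChar.map_add_eq_mul, Circle.coe_mul]
  ring

theorem Admissible.fourierIsometry_dilate (S : Admissible μ p ϖ ε χ) (j : ℤ) (f : Lp ℂ 2 μ) :
    S.fourierIsometry (S.dilateEquiv j f) = S.dilateEquiv (-j) (S.fourierIsometry f) := by
  refine eq_of_eq_on_bounded_support (A := fun f => S.fourierIsometry (S.dilateEquiv j f))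
    (B := fun f => S.dilateEquiv (-j) (S.fourierIsometry f))
    (S.fourierIsometry.continuous.comp (S.dilateEquiv j).continuous)
    ((S.dilateEquiv (-j)).continuous.comp S.fourierIsometry.continuous) (fun f R hf => ?_) f
  have h0 := S.prime.norm_pos
  have hs : ∀ᵐ x ∂μ, x ∉ Metric.closedBall (0 : K) (‖ϖ‖ ^ j * R) → S.dilateEquiv j f x = 0 := by
    filter_upwards [S.coeFn_dilateEquiv j f, (S.quasiMeasurePreserving (-j)).ae hf] with x h1 h2 hx
    rw [h1, h2, mul_zero]
    refine fun h => hx ?_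
    rw [mem_closedBall_zero_iff] at h ⊢
    rw [norm_mul, norm_zpow, zpow_neg] at h
    exact (inv_mul_le_iff₀ (zpow_pos h0 j)).mp h
  refine Lp.ext ?_
  have h1 : S.fourierIsometry (S.dilateEquiv j f) =ᵐ[μ] fourierIntegral μ χ (S.dilateEquiv j f) :=
    S.fourier_coeFn_of_support _ hs
  have h2 : S.fourierIsometry f =ᵐ[μ] fourierIntegral μ χ f := S.fourier_coeFn_of_support _ hf
  have h2' := (S.quasiMeasurePreserving (- -j)).ae h2
  have h4 : S.dilateEquiv j f =ᵐ[μ] ((((p ^ c : ℕ) : ℝ) ^ ((j : ℝ) / 2) : ℝ) : ℂ) •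
      fun x => f (ϖ ^ (-j) * x) := S.coeFn_dilateEquiv j f
  filter_upwards [h1, h2', S.coeFn_dilateEquiv (-j) (S.fourierIsometry f)] with ξ h1 h2 h3
  rw [h1, h3, h2, fourierIntegral_congr_ae h4, fourierIntegral_const_smul, Pi.smul_apply,
    S.fourierIntegral_comp_zpow_mul f, smul_eq_mul, Complex.real_smul, ← mul_assoc,
    ← Complex.ofReal_mul, ← Real.rpow_intCast, ← Real.rpow_add (card_pos p c)]
  congr 4
  push_cast
  ring

theorem Admissible.exists_fourier_eq_indicator_closedBall (S : Admissible μ p ϖ ε χ) (a : K)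
    (n : ℤ) : ∃ f : Lp ℂ 2 μ, S.fourierIsometry f =ᵐ[μ]
      (Metric.closedBall a (‖ϖ‖ ^ n)).indicator fun _ => 1 := by
  have hm : (μ.real (fracIdeal ϖ (-n)) : ℂ) ≠ 0 := by
    exact_mod_cast (measureReal_fracIdeal_pos S.prime (-n)).ne'
  set h : K → ℂ := (fracIdeal ϖ (-n)).indicator
    fun x => (μ.real (fracIdeal ϖ (-n)) : ℂ)⁻¹ * (χ (a * x) : ℂ) with hh
  have hL : MemLp h 2 μ := by
    rw [hh, memLp_indicator_iff_restrict (measurableSet_fracIdeal ϖ _)]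
    have hfin : IsFiniteMeasure (μ.restrict (fracIdeal ϖ (-n))) :=
      ⟨by simpa using measure_fracIdeal_lt_top ϖ (-n)⟩
    refine MemLp.of_bound (continuous_const.mul
      (S.continuous_char (by fun_prop))).aestronglyMeasurable
      ‖(μ.real (fracIdeal ϖ (-n)) : ℂ)⁻¹‖ (ae_of_all _ fun x => ?_)
    rw [norm_mul, Circle.norm_coe, mul_one]
  refine ⟨hL.toLp, ?_⟩
  have h1 : S.fourierIsometry hL.toLp =ᵐ[μ] fourierIntegral μ χ hL.toLp :=
    S.fourier_coeFn_of_support (R := ‖ϖ‖ ^ (-n)) _ (by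
      filter_upwards [hL.coeFn_toLp] with x hx hxn
      rw [hx]
      exact Set.indicator_of_notMem hxn _)
  rw [fourierIntegral_congr_ae hL.coeFn_toLp] at h1
  refine h1.trans (ae_of_all _ fun ξ => ?_)
  have h2 : fourierIntegral μ χ h ξ = (μ.real (fracIdeal ϖ (-n)) : ℂ)⁻¹ *
      ∫ x in fracIdeal ϖ (-n), (χ ((a - ξ) * x) : ℂ) ∂μ := by
    rw [fourierIntegral, ← integral_const_mul,
      ← integral_indicator (measurableSet_fracIdeal ϖ (-n))]
    congr 1
    funext x
    by_cases hx : x ∈ fracIdeal ϖ (-n)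
    · simp only [hh, Set.indicator_of_mem hx]
      rw [sub_mul, sub_eq_add_neg, AddChar.map_add_eq_mul, Circle.coe_mul]
      ring
    · simp only [hh, Set.indicator_of_notMem hx, zero_mul]
  have hiff : a - ξ ∈ fracIdeal ϖ (- -n) ↔ ξ ∈ Metric.closedBall a (‖ϖ‖ ^ n) := by
    rw [neg_neg, mem_fracIdeal, ← dist_eq_norm, dist_comm, Metric.mem_closedBall]
  rw [h2]
  by_cases hξ : ξ ∈ Metric.closedBall a (‖ϖ‖ ^ n)
  · rw [S.integral_char_of_mem (hiff.mpr hξ), Set.indicator_of_mem hξ, inv_mul_cancel₀ hm]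
  · rw [S.integral_char_of_notMem (mt hiff.mp hξ), Set.indicator_of_notMem hξ, mul_zero]

theorem Admissible.fourierIsometry_surjective (S : Admissible μ p ϖ ε χ) :
    Function.Surjective S.fourierIsometry := by
  have hc : IsClosed (S.fourierIsometry.range : Set (Lp ℂ 2 μ)) :=
    S.fourierIsometry.isometry.isClosedEmbedding.isClosed_range
  have : CompleteSpace S.fourierIsometry.range := hc.completeSpace_coe
  have htop : S.fourierIsometry.range = ⊤ := by
    rw [← Submodule.orthogonal_eq_bot_iff, Submodule.eq_bot_iff]
    intro g hg
    rw [Lp.eq_zero_iff_ae_eq_zero]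
    refine ae_eq_zero_of_forall_setIntegral_closedBall S.prime
      ((Lp.memLp g).locallyIntegrable one_le_two) fun a n => ?_
    obtain ⟨f, hf⟩ := S.exists_fourier_eq_indicator_closedBall a n
    have h := hg (S.fourierIsometry f) ⟨f, rfl⟩
    rw [L2.inner_def] at h
    rw [← h, ← integral_indicator measurableSet_closedBall]
    refine integral_congr_ae ?_
    filter_upwards [hf] with x hx
    rw [hx]
    by_cases hxa : x ∈ Metric.closedBall a (‖ϖ‖ ^ n)
    · simp [Set.indicator_of_mem hxa]
    · simp [Set.indicator_of_notMem hxa]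
  intro g
  have : g ∈ S.fourierIsometry.range := by rw [htop]; trivial
  exact this

end Operators

section Frames

variable {H : Type*} [NormedAddCommGroup H] [InnerProductSpace ℂ H] {e : ℕ → H}
  {V : Submodule ℂ H}

theorem IsParsevalFrame.hasSum_starProjection (he : IsParsevalFrame e V)
    [V.HasOrthogonalProjection] (f : H) :
    HasSum (fun k => ‖inner ℂ f (e k)‖ ^ 2) (‖V.starProjection f‖ ^ 2) := by
  convert he.2 (V.starProjection f) (V.starProjection_apply_mem f) using 4 with k
  rw [Submodule.inner_starProjection_left_eq_right,
    Submodule.starProjection_eq_self_iff.mpr (he.1 k)]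

/-- The analysis operator of a Parseval frame. -/
noncomputable def IsParsevalFrame.analysis (he : IsParsevalFrame e V) :
    V →ₗᵢ[ℂ] lp (fun _ : ℕ => ℂ) 2 where
  toFun f := ⟨fun k => inner ℂ (e k) (f : H), memℓp_gen (by
    simpa [norm_inner_symm (f : H)] using (he.2 f f.2).summable)⟩
  map_add' f g := by
    ext k
    exact inner_add_right _ _ _
  map_smul' r f := by
    ext k
    exact inner_smul_right _ _ _
  norm_map' f := by
    have h := lp.norm_rpow_eq_tsum (p := 2) (by norm_num)
      (⟨fun k => inner ℂ (e k) (f : H), memℓp_gen (by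
        simpa [norm_inner_symm (f : H)] using (he.2 f f.2).summable)⟩ : lp (fun _ : ℕ => ℂ) 2)
    have h2 := (he.2 f f.2).tsum_eq
    simp only [norm_inner_symm (f : H)] at h2
    simp only [ENNReal.toReal_ofNat, Real.rpow_two, h2] at h
    exact (sq_eq_sq₀ (norm_nonneg _) (norm_nonneg _)).mp h

theorem IsParsevalFrame.adjoint_analysis_single (he : IsParsevalFrame e V) [CompleteSpace V]
    (k : ℕ) (r : ℂ) :
    he.analysis.toContinuousLinearMap.adjoint (lp.single 2 k r) = r • (⟨e k, he.1 k⟩ : V) := by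
  refine ext_inner_left ℂ fun v => ?_
  rw [ContinuousLinearMap.adjoint_inner_right, lp.inner_single_right, inner_smul_right]
  change inner ℂ (inner ℂ (e k) (v : H)) r = r * inner ℂ (v : H) (e k)
  rw [RCLike.inner_apply, inner_conj_symm]

/-- A Parseval frame can be synthesized against square summable coefficients. -/
theorem IsParsevalFrame.hasSum_synthesis (he : IsParsevalFrame e V) [CompleteSpace V]
    (a : lp (fun _ : ℕ => ℂ) 2) :
    HasSum (fun k => a k • e k) (he.analysis.toContinuousLinearMap.adjoint a : H) := by
  have h := (lp.hasSum_single (by norm_num) a).mapL he.analysis.toContinuousLinearMap.adjoint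
  simp_rw [he.adjoint_analysis_single] at h
  exact h.mapL V.subtypeL

theorem IsParsevalFrame.hasSum_analysis (he : IsParsevalFrame e V) [CompleteSpace V] (f : V) :
    HasSum (fun k => he.analysis f k • e k) (f : H) := by
  convert he.hasSum_synthesis (he.analysis f)
  refine ext_inner_left ℂ fun v => ?_
  rw [ContinuousLinearMap.adjoint_inner_right]
  exact (he.analysis.inner_map_map v f).symm

end Frames

section FrequencyDomain

variable {K : Type*} [NontriviallyNormedField K] [IsUltrametricDist K] [ProperSpace K]
  [MeasurableSpace K] [BorelSpace K] {μ : Measure K} [μ.IsAddHaarMeasure]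
  {p : ℕ} [hp : Fact p.Prime] [CharP K p] {c : ℕ} [NeZero c] {ϖ : K} {ε : Fin c → K}
  {χ : AddChar K Circle}

theorem Admissible.fourier_translates (S : Admissible μ p ϖ ε χ) (φ : Lp ℂ 2 μ) (k : ℕ) :
    S.fourierIsometry (translates μ p ϖ ε φ k) =ᵐ[μ]
      fun ξ => (χ (-(u p ϖ ε k * ξ)) : ℂ) * S.fourierIsometry φ ξ := by
  rw [translates, S.fourierIsometry_translate]
  filter_upwards [S.coeFn_modulate (u p ϖ ε k) (S.fourierIsometry φ)] with ξ h
  rw [h, mul_comm ξ]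

theorem Admissible.hasSum_inner_translates (S : Admissible μ p ϖ ε χ) (φ h : Lp ℂ 2 μ)
    {g : K → ℂ} (hg : S.fourierIsometry h =ᵐ[μ] g)
    (hs : ∀ x ∉ Metric.closedBall (0 : K) 1, g x = 0)
    (hb : MemLp (fun ξ => (starRingEnd ℂ) (g ξ) * S.fourierIsometry φ ξ) 2 μ) :
    HasSum (fun k => ‖inner ℂ h (translates μ p ϖ ε φ k)‖ ^ 2)
      (∫ ξ, ‖g ξ‖ ^ 2 * ‖S.fourierIsometry φ ξ‖ ^ 2 ∂μ) := by
  convert S.hasSum_fourierCoeff (hb.restrict _) using 1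
  · funext k
    congr 2
    rw [← S.fourierIsometry.inner_map_map, L2.inner_def,
      setIntegral_eq_integral_of_forall_compl_eq_zero
        (fun x hx => by rw [hs x hx, map_zero, zero_mul, zero_mul])]
    refine integral_congr_ae ?_
    filter_upwards [S.fourier_translates φ k, hg] with ξ h1 h2
    rw [h1, h2, RCLike.inner_apply]
    ring
  · rw [setIntegral_eq_integral_of_forall_compl_eq_zero
        (fun x hx => by rw [hs x hx, map_zero, zero_mul, norm_zero, zero_pow two_ne_zero])]
    refine integral_congr_ae (ae_of_all _ fun ξ => ?_)
    simp only [norm_mul, RCLike.norm_conj, mul_pow]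

/-- If `f̂` is the indicator of a subset `A` of `ϖ ^ (-j) 𝒪`, then the coefficients of `D^(-j) f`
with respect to the translates of `φ` have square sum `∫_A |φ̂(ϖ ^ j ξ)|² dξ`. -/
theorem Admissible.hasSum_inner_dilate (S : Admissible μ p ϖ ε χ) (φ f : Lp ℂ 2 μ) {A : Set K}
    (hA : MeasurableSet A) (j : ℤ) (hAj : A ⊆ fracIdeal ϖ (-j))
    (hf : S.fourierIsometry f =ᵐ[μ] A.indicator fun _ => 1) :
    HasSum (fun k => ‖inner ℂ (S.dilateEquiv (-j) f) (translates μ p ϖ ε φ k)‖ ^ 2)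
      (∫ ξ in A, ‖S.fourierIsometry φ (ϖ ^ j * ξ)‖ ^ 2 ∂μ) := by
  set r : ℝ := ((p ^ c : ℕ) : ℝ) ^ ((j : ℝ) / 2) with hr
  have hr0 : 0 ≤ r := Real.rpow_nonneg (card_pos p c).le _
  have hr2 : r ^ 2 = ((p ^ c : ℕ) : ℝ) ^ j := by
    rw [hr, ← Real.rpow_natCast, ← Real.rpow_mul (card_pos p c).le, ← Real.rpow_intCast]
    congr 1
    push_cast
    ring
  set g : K → ℂ := fun ξ => (r : ℂ) * A.indicator (fun _ => 1) (ϖ ^ (-j) * ξ) with hgdef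
  have hg : S.fourierIsometry (S.dilateEquiv (-j) f) =ᵐ[μ] g := by
    rw [S.fourierIsometry_dilate, neg_neg]
    filter_upwards [S.coeFn_dilateEquiv j (S.fourierIsometry f),
      (S.quasiMeasurePreserving (-j)).ae hf] with ξ h1 h2
    rw [h1, h2]
  have hgm : Measurable g := measurable_const.mul
    ((measurable_const.indicator hA).comp (measurable_const_mul _))
  have hg1 (ξ : K) : ‖g ξ‖ ≤ r := by
    simp only [hgdef, norm_mul, Complex.norm_real, Real.norm_of_nonneg hr0]
    refine mul_le_of_le_one_right hr0 ((norm_indicator_le_norm_self _ _).trans (by simp))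
  have hb : MemLp (fun ξ => (starRingEnd ℂ) (g ξ) * S.fourierIsometry φ ξ) 2 μ := by
    refine (Lp.memLp (S.fourierIsometry φ)).of_le_mul (c := r)
      ((Complex.continuous_conj.measurable.comp hgm).aestronglyMeasurable.mul
        (Lp.aestronglyMeasurable _)) (ae_of_all _ fun ξ => ?_)
    rw [norm_mul, RCLike.norm_conj]
    gcongr
    exact hg1 ξ
  convert S.hasSum_inner_translates φ _ hg (fun x hx => ?_) hb using 1
  · have h := S.integral_zpow_mul (μ := μ) j
      fun ξ => A.indicator (fun _ => (1 : ℝ)) (ϖ ^ (-j) * ξ) * ‖S.fourierIsometry φ ξ‖ ^ 2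
    rw [← integral_indicator hA]
    calc _ = ∫ ξ, A.indicator (fun _ => (1 : ℝ)) (ϖ ^ (-j) * (ϖ ^ j * ξ)) *
          ‖S.fourierIsometry φ (ϖ ^ j * ξ)‖ ^ 2 ∂μ := by
          refine integral_congr_ae (ae_of_all _ fun ξ => ?_)
          simp only [← mul_assoc, ← zpow_add₀ S.prime.ne_zero, neg_add_cancel, zpow_zero, one_mul]
          by_cases hξ : ξ ∈ A
          · simp [hξ]
          · simp [hξ]
      _ = _ := by
          rw [h, ← hr2, ← integral_smul]
          refine integral_congr_ae (ae_of_all _ fun ξ => ?_)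
          simp only [hgdef, norm_mul, Complex.norm_real, Real.norm_of_nonneg hr0, mul_pow,
            smul_eq_mul]
          by_cases hξ : ϖ ^ (-j) * ξ ∈ A
          · simp [hξ, -zpow_neg]
          · simp [hξ, -zpow_neg]
  · have : ϖ ^ (-j) * x ∉ A := fun h => hx (by
      have h1 := hAj h
      rw [zpow_mul_mem_fracIdeal S.prime, sub_self, fracIdeal_zero] at h1
      exact h1)
    simp [hgdef, this, -zpow_neg]

theorem Admissible.exists_fourier_eq_indicator (S : Admissible μ p ϖ ε χ) {A : Set K}
    (hA : MeasurableSet A) (hAt : μ A ≠ ∞) : ∃ f : Lp ℂ 2 μ,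
      S.fourierIsometry f =ᵐ[μ] (A.indicator fun _ => 1) ∧ ‖f‖ ^ 2 = μ.real A := by
  obtain ⟨f, hf⟩ := S.fourierIsometry_surjective (indicatorConstLp 2 hA hAt (1 : ℂ))
  refine ⟨f, by rw [hf]; exact indicatorConstLp_coeFn, ?_⟩
  rw [← S.fourierIsometry.norm_map f, hf, norm_indicatorConstLp (by norm_num) (by norm_num),
    norm_one, one_mul, ENNReal.toReal_ofNat, ← Real.sqrt_eq_rpow,
    Real.sq_sqrt measureReal_nonneg]

theorem measure_ne_top_of_subset_fracIdeal {A : Set K} {m : ℤ} (h : A ⊆ fracIdeal ϖ m) :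
    μ A ≠ ∞ :=
  ((measure_mono h).trans_lt (measure_fracIdeal_lt_top ϖ m)).ne

theorem Admissible.integrable_norm_sq_dilate (S : Admissible μ p ϖ ε χ) (f : Lp ℂ 2 μ) (j : ℤ) :
    Integrable (fun ξ => ‖f (ϖ ^ j * ξ)‖ ^ 2) μ :=
  have h := S.memLp_comp_zpow_mul (Lp.memLp f) j
  (memLp_two_iff_integrable_sq_norm h.1).mp h

variable {φ : Lp ℂ 2 μ} {V : Submodule ℂ (Lp ℂ 2 μ)}

theorem Admissible.norm_sq_starProjection_dilate (S : Admissible μ p ϖ ε χ)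
    (he : IsParsevalFrame (translates μ p ϖ ε φ) V) [V.HasOrthogonalProjection] {A : Set K}
    (hA : MeasurableSet A) (j : ℤ) (hAj : A ⊆ fracIdeal ϖ (-j)) {f : Lp ℂ 2 μ}
    (hf : S.fourierIsometry f =ᵐ[μ] A.indicator fun _ => 1) :
    ‖V.starProjection (S.dilateEquiv (-j) f)‖ ^ 2 =
      ∫ ξ in A, ‖S.fourierIsometry φ (ϖ ^ j * ξ)‖ ^ 2 ∂μ :=
  (he.hasSum_starProjection _).unique (S.hasSum_inner_dilate φ f hA j hAj hf)

theorem Admissible.norm_fourier_le_one (S : Admissible μ p ϖ ε χ)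
    (he : IsParsevalFrame (translates μ p ϖ ε φ) V) [V.HasOrthogonalProjection] (j : ℤ) :
    ∀ᵐ ξ ∂μ, ξ ∈ fracIdeal ϖ (-j) → ‖S.fourierIsometry φ (ϖ ^ j * ξ)‖ ^ 2 ≤ 1 := by
  rw [← ae_restrict_iff' (measurableSet_fracIdeal ϖ _)]
  have hfin : IsFiniteMeasure (μ.restrict (fracIdeal ϖ (-j))) :=
    ⟨by simpa using measure_fracIdeal_lt_top ϖ (-j)⟩
  refine ae_le_of_forall_setIntegral_le (S.integrable_norm_sq_dilate _ j).restrict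
    (integrable_const 1) fun s hs _ => ?_
  rw [Measure.restrict_restrict hs]
  have hA := hs.inter (measurableSet_fracIdeal ϖ (-j))
  obtain ⟨f, hf, hfn⟩ := S.exists_fourier_eq_indicator hA
    (measure_ne_top_of_subset_fracIdeal Set.inter_subset_right)
  rw [← S.norm_sq_starProjection_dilate he hA j Set.inter_subset_right hf]
  simp only [setIntegral_const, smul_eq_mul, mul_one, ← hfn]
  rw [← (S.dilateEquiv (-j)).norm_map f]
  gcongr
  exact V.norm_starProjection_apply_le _

theorem Admissible.norm_starProjection_le_dilate (S : Admissible μ p ϖ ε χ)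
    [V.HasOrthogonalProjection] (hV : ∀ f ∈ V, S.dilateEquiv (-1) f ∈ V) (g : Lp ℂ 2 μ) :
    ‖V.starProjection g‖ ≤ ‖V.starProjection (S.dilateEquiv (-1) g)‖ := by
  set w := S.dilateEquiv (-1) (V.starProjection g) with hw
  have hwV : w ∈ V := hV _ (V.starProjection_apply_mem g)
  have hwn : ‖w‖ = ‖V.starProjection g‖ := (S.dilateEquiv (-1)).norm_map _
  have h1 : ‖V.starProjection g‖ ^ 2 = ‖inner ℂ w (V.starProjection (S.dilateEquiv (-1) g))‖ := by
    rw [← Submodule.inner_starProjection_left_eq_right,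
      Submodule.starProjection_eq_self_iff.mpr hwV, hw, LinearIsometryEquiv.inner_map_map]
    conv_rhs => rw [← Submodule.starProjection_eq_self_iff.mpr (V.starProjection_apply_mem g),
      Submodule.inner_starProjection_left_eq_right]
    rw [inner_self_eq_norm_sq_to_K]
    simp
  have h2 := norm_inner_le_norm (𝕜 := ℂ) w (V.starProjection (S.dilateEquiv (-1) g))
  rw [← h1, hwn, sq] at h2
  rcases (norm_nonneg (V.starProjection g)).eq_or_lt with h0 | h0
  · rw [← h0]; exact norm_nonneg _
  · exact le_of_mul_le_mul_left h2 h0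

theorem Admissible.norm_fourier_le_succ (S : Admissible μ p ϖ ε χ)
    (he : IsParsevalFrame (translates μ p ϖ ε φ) V) [V.HasOrthogonalProjection]
    (hV : ∀ f ∈ V, S.dilateEquiv (-1) f ∈ V) (j : ℤ) :
    ∀ᵐ ξ ∂μ, ξ ∈ fracIdeal ϖ (-j) →
      ‖S.fourierIsometry φ (ϖ ^ j * ξ)‖ ^ 2 ≤ ‖S.fourierIsometry φ (ϖ ^ (j + 1) * ξ)‖ ^ 2 := by
  rw [← ae_restrict_iff' (measurableSet_fracIdeal ϖ _)]
  refine ae_le_of_forall_setIntegral_le (S.integrable_norm_sq_dilate _ j).restrict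
    (S.integrable_norm_sq_dilate _ (j + 1)).restrict fun s hs _ => ?_
  rw [Measure.restrict_restrict hs]
  have hA := hs.inter (measurableSet_fracIdeal ϖ (-j))
  obtain ⟨f, hf, -⟩ := S.exists_fourier_eq_indicator hA
    (measure_ne_top_of_subset_fracIdeal Set.inter_subset_right)
  rw [← S.norm_sq_starProjection_dilate he hA j Set.inter_subset_right hf,
    ← S.norm_sq_starProjection_dilate he hA (j + 1)
      (Set.inter_subset_right.trans (fracIdeal_antitone S.prime (by omega))) hf]
  gcongr
  have h := S.norm_starProjection_le_dilate hV (S.dilateEquiv (-j) f)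
  rwa [S.dilateEquiv_dilateEquiv, show (-1 + -j : ℤ) = -(j + 1) by ring] at h

theorem Admissible.dilate_mem_of_nonpos (S : Admissible μ p ϖ ε χ)
    (hV : ∀ f ∈ V, S.dilateEquiv (-1) f ∈ V) (n : ℕ) {f : Lp ℂ 2 μ} (hf : f ∈ V) :
    S.dilateEquiv (-(n : ℤ)) f ∈ V := by
  induction n with
  | zero => simpa [S.dilateEquiv_zero] using hf
  | succ n ih =>
    have h := hV _ ih
    rwa [S.dilateEquiv_dilateEquiv, show (-1 + -(n : ℤ)) = -((n + 1 : ℕ) : ℤ) by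
      push_cast; ring] at h

/-- If `⋃ D^j V` is dense, the projections of `f` onto `D^j V` converge in norm. -/
theorem Admissible.tendsto_norm_starProjection (S : Admissible μ p ϖ ε χ)
    [V.HasOrthogonalProjection] (hV : ∀ f ∈ V, S.dilateEquiv (-1) f ∈ V)
    (hd : closure (⋃ j : ℤ, S.dilateEquiv j '' (V : Set (Lp ℂ 2 μ))) = Set.univ)
    (f : Lp ℂ 2 μ) :
    Tendsto (fun j : ℕ => ‖V.starProjection (S.dilateEquiv (-(j : ℤ)) f)‖) atTop (𝓝 ‖f‖) := by
  rw [Metric.tendsto_atTop]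
  intro δ hδ
  have hmem : f ∈ closure (⋃ j : ℤ, S.dilateEquiv j '' (V : Set (Lp ℂ 2 μ))) := by
    rw [hd]; trivial
  obtain ⟨h, hh, hfh⟩ := Metric.mem_closure_iff.mp hmem δ hδ
  obtain ⟨i, w, hw, rfl⟩ := Set.mem_iUnion.mp hh
  refine ⟨i.toNat, fun j hj => ?_⟩
  have hij : i ≤ j := Int.toNat_le.mp hj
  have hwV : S.dilateEquiv (-(j : ℤ)) (S.dilateEquiv i w) ∈ V := by
    have := S.dilate_mem_of_nonpos hV (j - i).toNat hw
    rw [S.dilateEquiv_dilateEquiv]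
    rwa [Int.toNat_of_nonneg (by omega), show -((j : ℤ) - i) = -(j : ℤ) + i by ring] at this
  set g := S.dilateEquiv (-(j : ℤ)) f with hg
  set v := S.dilateEquiv (-(j : ℤ)) (S.dilateEquiv i w) with hv
  have hgn : ‖g‖ = ‖f‖ := (S.dilateEquiv _).norm_map f
  have hgv : ‖g - v‖ < δ := by
    rw [hg, hv, ← map_sub, LinearIsometryEquiv.norm_map, ← dist_eq_norm]
    exact hfh
  have h1 : ‖g - V.starProjection g‖ ≤ ‖g - v‖ := by
    have : g - V.starProjection g = (g - v) - V.starProjection (g - v) := by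
      rw [map_sub, Submodule.starProjection_eq_self_iff.mpr hwV]
      abel
    rw [this, ← Submodule.starProjection_orthogonal_val]
    exact Submodule.norm_starProjection_apply_le _ _
  have h2 : ‖g‖ ≤ ‖V.starProjection g‖ + ‖g - V.starProjection g‖ := by
    simpa using norm_add_le (V.starProjection g) (g - V.starProjection g)
  have h3 := V.norm_starProjection_apply_le g
  rw [Real.dist_eq, abs_lt]
  constructor <;> linarith

/-- The density of `⋃ D^j V` forces `|φ̂(ϖ ^ j ξ)| → 1` a.e. -/
theorem Admissible.tendsto_norm_fourier (S : Admissible μ p ϖ ε χ)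
    (he : IsParsevalFrame (translates μ p ϖ ε φ) V) [V.HasOrthogonalProjection]
    (hV : ∀ f ∈ V, S.dilateEquiv (-1) f ∈ V)
    (hd : closure (⋃ j : ℤ, S.dilateEquiv j '' (V : Set (Lp ℂ 2 μ))) = Set.univ) :
    ∀ᵐ ξ ∂μ, Tendsto (fun j : ℕ => ‖S.fourierIsometry φ (ϖ ^ j * ξ)‖) atTop (𝓝 1) := by
  have hle : ∀ᵐ ξ ∂μ, ∀ j : ℕ, ξ ∈ fracIdeal ϖ (-(j : ℤ)) →
      ‖S.fourierIsometry φ (ϖ ^ (j : ℤ) * ξ)‖ ^ 2 ≤ 1 :=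
    ae_all_iff.mpr fun j => S.norm_fourier_le_one he j
  have hmono : ∀ᵐ ξ ∂μ, ∀ j : ℕ, ξ ∈ fracIdeal ϖ (-(j : ℤ)) →
      ‖S.fourierIsometry φ (ϖ ^ (j : ℤ) * ξ)‖ ^ 2 ≤
        ‖S.fourierIsometry φ (ϖ ^ ((j : ℤ) + 1) * ξ)‖ ^ 2 :=
    ae_all_iff.mpr fun j => S.norm_fourier_le_succ he hV j
  have hinf (m : ℕ) : ∀ᵐ ξ ∂μ, ξ ∈ fracIdeal ϖ (-(m : ℤ)) →
      ⨅ j : ℕ, ENNReal.ofReal (1 - ‖S.fourierIsometry φ (ϖ ^ ((j + m : ℕ) : ℤ) * ξ)‖ ^ 2) = 0 := by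
    have hB := measurableSet_fracIdeal ϖ (-(m : ℤ))
    have hfin : IsFiniteMeasure (μ.restrict (fracIdeal ϖ (-(m : ℤ)))) :=
      ⟨by simpa using measure_fracIdeal_lt_top ϖ (-(m : ℤ))⟩
    rw [← ae_restrict_iff' hB]
    have hmeas (j : ℕ) : AEMeasurable (fun ξ => ENNReal.ofReal
        (1 - ‖S.fourierIsometry φ (ϖ ^ ((j + m : ℕ) : ℤ) * ξ)‖ ^ 2))
        (μ.restrict (fracIdeal ϖ (-(m : ℤ)))) :=
      ((S.integrable_norm_sq_dilate (S.fourierIsometry φ)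
        ((j + m : ℕ) : ℤ)).aestronglyMeasurable.aemeasurable.restrict.const_sub 1).ennreal_ofReal
    refine (lintegral_eq_zero_iff' (AEMeasurable.iInf hmeas)).mp ?_
    obtain ⟨f, hf, hfn⟩ := S.exists_fourier_eq_indicator hB
      (measure_ne_top_of_subset_fracIdeal subset_rfl)
    have hsub (j : ℕ) : fracIdeal ϖ (-(m : ℤ)) ⊆ fracIdeal ϖ (-((j + m : ℕ) : ℤ)) :=
      fracIdeal_antitone S.prime (by push_cast; omega)
    have hval (j : ℕ) : ∫⁻ ξ in fracIdeal ϖ (-(m : ℤ)), ENNReal.ofReal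
        (1 - ‖S.fourierIsometry φ (ϖ ^ ((j + m : ℕ) : ℤ) * ξ)‖ ^ 2) ∂μ =
        ENNReal.ofReal (‖f‖ ^ 2 -
          ‖V.starProjection (S.dilateEquiv (-((j + m : ℕ) : ℤ)) f)‖ ^ 2) := by
      rw [← ofReal_integral_eq_lintegral_ofReal]
      · rw [integral_sub (integrable_const 1) (S.integrable_norm_sq_dilate _ _).restrict,
          S.norm_sq_starProjection_dilate he hB ((j + m : ℕ) : ℤ) (hsub j) hf, hfn]
        simp
      · exact (integrable_const 1).sub (S.integrable_norm_sq_dilate _ _).restrict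
      · refine (ae_restrict_iff' hB).mpr ?_
        filter_upwards [hle] with ξ h hξ
        exact sub_nonneg.mpr (h (j + m) (hsub j hξ))
    have hlim : Tendsto (fun j : ℕ => ENNReal.ofReal (‖f‖ ^ 2 -
        ‖V.starProjection (S.dilateEquiv (-((j + m : ℕ) : ℤ)) f)‖ ^ 2)) atTop (𝓝 0) := by
      have h := ((S.tendsto_norm_starProjection hV hd f).comp (tendsto_add_atTop_nat m)).pow 2
      have h' := (tendsto_const_nhds (x := ‖f‖ ^ 2)).sub h
      rw [sub_self] at h'
      simpa using ENNReal.tendsto_ofReal h'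
    refine le_antisymm (ge_of_tendsto' hlim fun j => ?_) zero_le
    rw [← hval j]
    exact lintegral_mono fun ξ => iInf_le _ j
  filter_upwards [hle, hmono, ae_all_iff.mpr hinf] with ξ h1 h2 h3
  obtain ⟨m, hm⟩ := exists_norm_le_zpow S.prime ‖ξ‖
  have hξ (j : ℕ) (hj : m ≤ j) : ξ ∈ fracIdeal ϖ (-(j : ℤ)) :=
    fracIdeal_antitone S.prime (by omega) (mem_fracIdeal.mpr hm)
  have hmono' (i j : ℕ) (hi : m ≤ i) (hij : i ≤ j) : ‖S.fourierIsometry φ (ϖ ^ (i : ℤ) * ξ)‖ ^ 2 ≤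
      ‖S.fourierIsometry φ (ϖ ^ (j : ℤ) * ξ)‖ ^ 2 := by
    induction j, hij using Nat.le_induction with
    | base => exact le_rfl
    | succ j hj ih => exact ih.trans (by exact_mod_cast h2 j (hξ j (hi.trans hj)))
  have hsq : Tendsto (fun j : ℕ => ‖S.fourierIsometry φ (ϖ ^ (j : ℤ) * ξ)‖ ^ 2) atTop (𝓝 1) := by
    rw [Metric.tendsto_atTop]
    intro δ hδ
    have h4 : ⨅ j : ℕ, ENNReal.ofReal
        (1 - ‖S.fourierIsometry φ (ϖ ^ ((j + m : ℕ) : ℤ) * ξ)‖ ^ 2) < ENNReal.ofReal δ := by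
      rw [h3 m (hξ m le_rfl)]
      exact ENNReal.ofReal_pos.mpr hδ
    obtain ⟨i, hi⟩ := iInf_lt_iff.mp h4
    have hi' := (ENNReal.ofReal_lt_ofReal_iff hδ).mp hi
    refine ⟨i + m, fun j hj => ?_⟩
    have h5 := hmono' (i + m) j (by omega) hj
    have h6 := h1 j (hξ j (by omega))
    rw [Real.dist_eq, abs_lt]
    constructor <;> linarith
  have := hsq.sqrt
  simpa using this

end FrequencyDomain

section Refinement

variable {K : Type*} [NontriviallyNormedField K] [IsUltrametricDist K] [ProperSpace K]
  [MeasurableSpace K] [BorelSpace K] {μ : Measure K} [μ.IsAddHaarMeasure]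
  {p : ℕ} [hp : Fact p.Prime] [CharP K p] {c : ℕ} [NeZero c] {ϖ : K} {ε : Fin c → K}
  {χ : AddChar K Circle} {φ : Lp ℂ 2 μ} {V : Submodule ℂ (Lp ℂ 2 μ)}

theorem coeFn_sum_smul {α : Type*} [MeasurableSpace α] {ν : Measure α} (a : ℕ → ℂ)
    (f : ℕ → Lp ℂ 2 ν) (N : ℕ) :
    (∑ k ∈ Finset.range N, a k • f k : Lp ℂ 2 ν) =ᵐ[ν]
      fun x => ∑ k ∈ Finset.range N, a k * f k x := by
  induction N with
  | zero =>
    filter_upwards [Lp.coeFn_zero ℂ 2 ν] with x hx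
    simpa using hx
  | succ N ih =>
    rw [Finset.sum_range_succ]
    filter_upwards [ih, Lp.coeFn_add (∑ k ∈ Finset.range N, a k • f k) (a N • f N),
      Lp.coeFn_smul (a N) (f N)] with x h1 h2 h3
    rw [h2, Pi.add_apply, h1, h3, Finset.sum_range_succ, Pi.smul_apply, smul_eq_mul]

/-- If `ψ = ∑ aₖ T_k φ` with square summable coefficients, then `ψ̂ = m φ̂`, where `m` is the
integral periodic function given on `𝒪` by the Fourier series `∑ aₖ χ(-u(k) ξ)`. -/
theorem Admissible.fourier_eq_mul_of_hasSum (S : Admissible μ p ϖ ε χ)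
    (a : lp (fun _ : ℕ => ℂ) 2) {ψ : Lp ℂ 2 μ}
    (hψ : HasSum (fun k => a k • translates μ p ϖ ε φ k) ψ) {m : K → ℂ}
    (hper : IntegralPeriodic p ϖ ε m)
    (hm : S.charBasis.repr.symm a =ᵐ[integersMeasure μ] m) :
    S.fourierIsometry ψ =ᵐ[μ] fun ξ => m ξ * S.fourierIsometry φ ξ := by
  set t : ℕ → K → ℂ := fun N ξ =>
    ∑ k ∈ Finset.range N, a k * (χ (-(u p ϖ ε k * ξ)) : ℂ) with ht
  have htper (N k : ℕ) (ξ : K) : t N (ξ - u p ϖ ε k) = t N ξ := by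
    simp only [ht]
    refine Finset.sum_congr rfl fun l _ => ?_
    rw [mul_sub, neg_sub, sub_eq_add_neg, AddChar.map_add_eq_mul, S.character.map_u_mul_u, one_mul]
  have h1 := (S.charBasis.hasSum_repr_symm a).tendsto_sum_nat
  obtain ⟨n, hn, hlim⟩ := (tendstoInMeasure_of_tendsto_Lp h1).exists_seq_tendsto_ae
  have hS : ∀ᵐ ξ ∂integersMeasure μ, ∀ N,
      (∑ k ∈ Finset.range N, a k • S.charBasis k : Lp ℂ 2 (integersMeasure μ)) ξ = t N ξ := by
    refine ae_all_iff.mpr fun N => ?_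
    have hch : ∀ᵐ ξ ∂integersMeasure μ, ∀ k, S.charBasis k ξ = (χ (-(u p ϖ ε k * ξ)) : ℂ) :=
      ae_all_iff.mpr fun k => by
        rw [S.charBasis_apply]
        exact (S.memLp_char k).coeFn_toLp
    filter_upwards [coeFn_sum_smul a S.charBasis N, hch] with ξ h2 h3
    simp only [h2, h3, ht]
  have hK : ∀ᵐ ξ ∂μ, Tendsto (fun i => t (n i) ξ) atTop (𝓝 (m ξ)) := by
    refine S.ae_of_ae_restrict (P := fun ξ => Tendsto (fun i => t (n i) ξ) atTop (𝓝 (m ξ)))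
      (fun k ξ h => ?_) ?_
    · simp only [htper] at h
      have h2 := hper k (ξ - u p ϖ ε k)
      rw [sub_add_cancel] at h2
      rwa [h2]
    · filter_upwards [hlim, hS, hm] with ξ h2 h3 h4
      simpa only [h3, h4] using h2
  have h2 := ((S.fourierIsometry.continuous.tendsto ψ).comp hψ.tendsto_sum_nat).comp
    hn.tendsto_atTop
  obtain ⟨i, hi, hlim'⟩ := (tendstoInMeasure_of_tendsto_Lp h2).exists_seq_tendsto_ae
  have hF : ∀ᵐ ξ ∂μ, ∀ N,
      S.fourierIsometry (∑ k ∈ Finset.range N, a k • translates μ p ϖ ε φ k) ξ =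
        t N ξ * S.fourierIsometry φ ξ := by
    refine ae_all_iff.mpr fun N => ?_
    simp only [map_sum, map_smul]
    filter_upwards [coeFn_sum_smul a (fun k => S.fourierIsometry (translates μ p ϖ ε φ k)) N,
      ae_all_iff.mpr (S.fourier_translates φ)] with ξ h3 h4
    simp only [h3, h4, ht, Finset.sum_mul, mul_assoc]
  filter_upwards [hK, hlim', hF] with ξ h3 h4 h5
  simp only [Function.comp, h5] at h4
  exact tendsto_nhds_unique h4 ((h3.comp hi.tendsto_atTop).mul_const _)

theorem Admissible.u_mem_congr (S : Admissible μ p ϖ ε χ) {x : K} {k l : ℕ}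
    (hk : ‖x - u p ϖ ε k‖ ≤ 1) (hl : ‖x - u p ϖ ε l‖ ≤ 1) : k = l := by
  refine eq_of_norm_u_sub_le (p := p) S.prime S.basis ?_
  have := norm_sub_le_max_ultra (x - u p ϖ ε l) (x - u p ϖ ε k)
  rw [sub_sub_sub_cancel_left] at this
  exact this.trans (max_le hl hk)

/-- Every function on `𝒪` extends to an integral periodic function. -/
theorem Admissible.exists_integralPeriodic (S : Admissible μ p ϖ ε χ) (M : K → ℂ) :
    ∃ m : K → ℂ, IntegralPeriodic p ϖ ε m ∧ ∀ x ∈ Metric.closedBall (0 : K) 1, m x = M x := by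
  choose k hk using exists_norm_sub_u_le (p := p) (ε := ε) S.prime S.basis
  refine ⟨fun x => M (x - u p ϖ ε (k x)), fun l x => ?_, fun x hx => ?_⟩
  · obtain ⟨n, hn⟩ := exists_u_add (p := p) (ϖ := ϖ) (ε := ε) (k x) l
    have hx : x + u p ϖ ε l - u p ϖ ε n = x - u p ϖ ε (k x) := by rw [hn]; ring
    have : k (x + u p ϖ ε l) = n := S.u_mem_congr (hk _) (by rw [hx]; exact hk x)
    simp only [this, hx]
  · have : k x = 0 := S.u_mem_congr (hk x) (by simpa [u_zero] using hx)
    simp only [this, u_zero, sub_zero]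

theorem Admissible.fourier_dilate_neg_one (S : Admissible μ p ϖ ε χ) (φ : Lp ℂ 2 μ) :
    S.fourierIsometry (S.dilateEquiv (-1) φ) =ᵐ[μ] fun ξ =>
      ((((p ^ c : ℕ) : ℝ) ^ (((1 : ℤ) : ℝ) / 2) : ℝ) : ℂ) *
        S.fourierIsometry φ (ϖ ^ (-1 : ℤ) * ξ) := by
  rw [S.fourierIsometry_dilate, neg_neg]
  exact S.coeFn_dilateEquiv 1 _

/-- The refinement equation in the Fourier domain. -/
theorem Admissible.exists_filter (S : Admissible μ p ϖ ε χ)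
    (he : IsParsevalFrame (translates μ p ϖ ε φ) V) [CompleteSpace V]
    (h : S.dilateEquiv (-1) φ ∈ V) :
    ∃ m₀ : K → ℂ, IntegralPeriodic p ϖ ε m₀ ∧ MemLp m₀ 2 (integersMeasure μ) ∧
      ∀ᵐ ξ ∂μ, S.fourierIsometry φ ξ = m₀ (ϖ * ξ) * S.fourierIsometry φ (ϖ * ξ) := by
  set a := he.analysis ⟨_, h⟩
  obtain ⟨m, hm, hmO⟩ := S.exists_integralPeriodic (S.charBasis.repr.symm a)
  have hae : S.charBasis.repr.symm a =ᵐ[integersMeasure μ] m := by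
    refine (ae_restrict_iff' measurableSet_closedBall).mpr (ae_of_all _ fun x hx => ?_)
    exact (hmO x hx).symm
  have hF := S.fourier_eq_mul_of_hasSum a (he.hasSum_analysis ⟨_, h⟩) hm hae
  set r : ℂ := ((((p ^ c : ℕ) : ℝ) ^ (((1 : ℤ) : ℝ) / 2) : ℝ) : ℂ) with hr
  have hr0 : r ≠ 0 := by
    rw [hr]
    exact_mod_cast (Real.rpow_pos_of_pos (card_pos p c) _).ne'
  refine ⟨fun ξ => r⁻¹ * m ξ, fun l x => by simp only [hm l x], ?_, ?_⟩
  · exact ((memLp_congr_ae hae).mp (Lp.memLp _)).const_mul r⁻¹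
  · have h1 := (S.quasiMeasurePreserving 1).ae (hF.symm.trans (S.fourier_dilate_neg_one φ))
    filter_upwards [h1] with ξ h2
    rw [← mul_assoc, ← zpow_add₀ S.prime.ne_zero, neg_add_cancel, zpow_zero, one_mul,
      zpow_one] at h2
    rw [mul_assoc, h2, inv_mul_cancel_left₀ hr0]

theorem Admissible.dilate_mem_of_filter (S : Admissible μ p ϖ ε χ)
    (he : IsParsevalFrame (translates μ p ϖ ε φ) V) [CompleteSpace V] {m₀ : K → ℂ}
    (hper : IntegralPeriodic p ϖ ε m₀) (hL : MemLp m₀ 2 (integersMeasure μ))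
    (hm : ∀ᵐ ξ ∂μ, S.fourierIsometry φ ξ = m₀ (ϖ * ξ) * S.fourierIsometry φ (ϖ * ξ)) :
    S.dilateEquiv (-1) φ ∈ V := by
  set r : ℂ := ((((p ^ c : ℕ) : ℝ) ^ (((1 : ℤ) : ℝ) / 2) : ℝ) : ℂ) with hr
  have hL' := hL.const_mul r
  set a := S.charBasis.repr hL'.toLp with ha
  have hψ := he.hasSum_synthesis a
  set ψ : V := he.analysis.toContinuousLinearMap.adjoint a
  have hF := S.fourier_eq_mul_of_hasSum a hψ (m := fun ξ => r * m₀ ξ)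
    (fun l x => by simp only [hper l x]) (by
      rw [ha, LinearIsometryEquiv.symm_apply_apply]
      exact hL'.coeFn_toLp)
  have heq : S.fourierIsometry (S.dilateEquiv (-1) φ) = S.fourierIsometry ψ := by
    refine Lp.ext ?_
    filter_upwards [hF, S.fourier_dilate_neg_one φ, (S.quasiMeasurePreserving (-1)).ae hm]
      with ξ h1 h2 h3
    rw [h1, h2, h3, ← mul_assoc ϖ, ← zpow_one_add₀ S.prime.ne_zero, add_neg_cancel, zpow_zero,
      one_mul, mul_assoc]
  rw [S.fourierIsometry.injective heq]
  exact ψ.2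

/-- `x ↦ ∑ₖ |φ(x - u k)|²`. -/
noncomputable def periodization (p : ℕ) (ϖ : K) (ε : Fin c → K) (φ : K → ℂ) (x : K) : ℝ≥0∞ :=
  ∑' k, ‖φ (x - u p ϖ ε k)‖ₑ ^ 2

theorem aemeasurable_enorm_sub_sq (φ : Lp ℂ 2 μ) (a : K) :
    AEMeasurable (fun x => ‖φ (x - a)‖ₑ ^ 2) μ :=
  ((Lp.aestronglyMeasurable φ).comp_measurePreserving
    (measurePreserving_sub_right μ a)).enorm.pow_const 2

theorem Admissible.lintegral_periodization (S : Admissible μ p ϖ ε χ) (φ : Lp ℂ 2 μ) :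
    ∫⁻ x in Metric.closedBall 0 1, periodization p ϖ ε φ x ∂μ = ∫⁻ x, ‖φ x‖ₑ ^ 2 ∂μ := by
  rw [S.lintegral_eq_tsum_sub]
  exact lintegral_tsum fun k => (aemeasurable_enorm_sub_sq φ _).restrict

theorem Admissible.tendsto_measure_fracIdeal (S : Admissible μ p ϖ ε χ) :
    Tendsto (fun n : ℕ => μ (fracIdeal ϖ n)) atTop (𝓝 0) := by
  have h (n : ℕ) : μ (fracIdeal ϖ n) = ((p ^ c : ℕ) : ℝ≥0∞)⁻¹ ^ n := by
    have h1 := congrArg (fun ν : Measure K => ν (Metric.closedBall (0 : K) 1))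
      (S.map_zpow_mul (-(n : ℤ)))
    simp only [Measure.smul_apply, S.measure_integers, smul_eq_mul, mul_one] at h1
    rw [Measure.map_apply (measurable_const_mul _) measurableSet_closedBall] at h1
    rw [← ENNReal.inv_pow, ← zpow_natCast, ← ENNReal.zpow_neg, ← h1]
    congr 1
    ext x
    rw [Set.mem_preimage, ← fracIdeal_zero (ϖ := ϖ), zpow_mul_mem_fracIdeal S.prime, zero_sub,
      neg_neg]
  simp_rw [h]
  refine ENNReal.tendsto_pow_atTop_nhds_zero_of_lt_one ?_
  rw [ENNReal.inv_lt_one]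
  exact_mod_cast one_lt_card_residue p c

/-- Bessel coefficients of functions concentrated near `0`. -/
theorem tsum_inner_translates_le (φ h : Lp ℂ 2 μ) {n : ℤ}
    (hs : ∀ᵐ x ∂μ, x ∉ fracIdeal ϖ n → h x = 0) :
    ∑' k, ENNReal.ofReal (‖inner ℂ h (translates μ p ϖ ε φ k)‖ ^ 2) ≤
      ENNReal.ofReal (‖h‖ ^ 2) * ∫⁻ x in fracIdeal ϖ n, periodization p ϖ ε φ x ∂μ := by
  have hB := measurableSet_fracIdeal ϖ n
  unfold periodization
  rw [lintegral_tsum fun k => (aemeasurable_enorm_sub_sq φ _).restrict, ← ENNReal.tsum_mul_left]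
  refine ENNReal.tsum_le_tsum fun k => ?_
  set T := translates μ p ϖ ε φ k with hT
  have hTB := (Lp.memLp T).indicator hB
  have h1 : inner ℂ h T = inner ℂ h hTB.toLp := by
    rw [L2.inner_def, L2.inner_def]
    refine integral_congr_ae ?_
    filter_upwards [hs, hTB.coeFn_toLp] with x h2 h3
    rw [h3]
    by_cases hx : x ∈ fracIdeal ϖ n
    · rw [Set.indicator_of_mem hx]
    · rw [h2 hx, inner_zero_left, inner_zero_left]
  have h2 : ENNReal.ofReal (‖hTB.toLp‖ ^ 2) =
      ∫⁻ x in fracIdeal ϖ n, ‖φ (x - u p ϖ ε k)‖ₑ ^ 2 ∂μ := by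
    rw [ofReal_norm_sq_eq_lintegral, ← lintegral_indicator hB]
    refine lintegral_congr_ae ?_
    filter_upwards [hTB.coeFn_toLp, coeFn_translate (u p ϖ ε k) φ] with x h3 h4
    rw [h3]
    by_cases hx : x ∈ fracIdeal ϖ n
    · rw [Set.indicator_of_mem hx, Set.indicator_of_mem hx, hT, translates, h4]
    · simp [Set.indicator_of_notMem hx]
  rw [← h2, ← ENNReal.ofReal_mul (by positivity), h1, ← mul_pow]
  exact ENNReal.ofReal_le_ofReal (by gcongr; exact norm_inner_le_norm _ _)

/-- The spaces `D^j V` of a Parseval frame of translates have trivial intersection. -/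
theorem Admissible.eq_zero_of_forall_mem_dilate (S : Admissible μ p ϖ ε χ)
    (he : IsParsevalFrame (translates μ p ϖ ε φ) V) [V.HasOrthogonalProjection]
    {f : Lp ℂ 2 μ} (hf : ∀ j : ℤ, S.dilateEquiv j f ∈ V) : f = 0 := by
  have key (N : ℕ) : inner ℂ f (truncLp f N) = (0 : ℂ) := by
    set g := truncLp f N with hg
    obtain ⟨M, hM⟩ := exists_closedBall_subset_fracIdeal S.prime (N : ℝ)
    have hgs : ∀ᵐ x ∂μ, x ∉ fracIdeal ϖ (-(M : ℤ)) → g x = 0 := by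
      filter_upwards [coeFn_truncLp f N] with x hx hxM
      rw [hg, hx, Set.indicator_of_notMem fun h => hxM (hM h)]
    have hds (j : ℕ) : ∀ᵐ x ∂μ, x ∉ fracIdeal ϖ (j : ℤ) →
        S.dilateEquiv ((j + M : ℕ) : ℤ) g x = 0 := by
      filter_upwards [S.coeFn_dilateEquiv ((j + M : ℕ) : ℤ) g,
        (S.quasiMeasurePreserving (-((j + M : ℕ) : ℤ))).ae hgs] with x h1 h2 hx
      rw [h1, h2, mul_zero]
      rw [zpow_mul_mem_fracIdeal S.prime]
      rwa [show (-(M : ℤ) - -((j + M : ℕ) : ℤ)) = j by push_cast; ring]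
    have hbound (j : ℕ) :
        ENNReal.ofReal (‖V.starProjection (S.dilateEquiv ((j + M : ℕ) : ℤ) g)‖ ^ 2) ≤
          ENNReal.ofReal (‖g‖ ^ 2) *
            ∫⁻ x in fracIdeal ϖ (j : ℤ), periodization p ϖ ε φ x ∂μ := by
      have h1 := he.hasSum_starProjection (S.dilateEquiv ((j + M : ℕ) : ℤ) g)
      rw [← h1.tsum_eq, ENNReal.ofReal_tsum_of_nonneg (fun _ => by positivity) h1.summable]
      have h2 := tsum_inner_translates_le (p := p) (ε := ε) φ _ (hds j)
      rwa [LinearIsometryEquiv.norm_map] at h2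
    have hzero : Tendsto (fun j : ℕ => ENNReal.ofReal (‖g‖ ^ 2) *
        ∫⁻ x in fracIdeal ϖ (j : ℤ), periodization p ϖ ε φ x ∂μ) atTop (𝓝 0) := by
      have hfin : ∫⁻ x in Metric.closedBall 0 1, periodization p ϖ ε φ x ∂μ ≠ ∞ := by
        rw [S.lintegral_periodization]
        exact (lintegral_enorm_sq_lt_top (Lp.memLp φ)).ne
      have h1 := tendsto_setLIntegral_zero hfin (l := atTop) (s := fun j : ℕ => fracIdeal ϖ j) (by
        refine tendsto_of_tendsto_of_tendsto_of_le_of_le tendsto_const_nhds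
          S.tendsto_measure_fracIdeal (fun _ => zero_le) fun j => ?_
        exact Measure.restrict_apply_le _ _)
      have h2 (j : ℕ) : (μ.restrict (Metric.closedBall (0 : K) 1)).restrict (fracIdeal ϖ j) =
          μ.restrict (fracIdeal ϖ j) := by
        rw [Measure.restrict_restrict (measurableSet_fracIdeal ϖ _), Set.inter_eq_left.mpr]
        rw [← fracIdeal_zero (ϖ := ϖ)]
        exact fracIdeal_antitone S.prime (by omega)
      simp_rw [h2] at h1
      have h3 := ENNReal.Tendsto.const_mul (a := ENNReal.ofReal (‖g‖ ^ 2)) h1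
        (Or.inr ENNReal.ofReal_ne_top)
      rwa [mul_zero] at h3
    have hproj : Tendsto (fun j : ℕ => ‖V.starProjection (S.dilateEquiv ((j + M : ℕ) : ℤ) g)‖ ^ 2)
        atTop (𝓝 0) := by
      have h1 := tendsto_of_tendsto_of_tendsto_of_le_of_le tendsto_const_nhds hzero
        (fun _ => zero_le) hbound
      have h2 := (ENNReal.tendsto_toReal ENNReal.zero_ne_top).comp h1
      refine (h2.congr fun j => ?_)
      exact ENNReal.toReal_ofReal (by positivity)
    have hproj' : Tendsto (fun j : ℕ =>
        ‖f‖ * ‖V.starProjection (S.dilateEquiv ((j + M : ℕ) : ℤ) g)‖) atTop (𝓝 0) := by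
      have := (hproj.sqrt).const_mul ‖f‖
      simpa using this
    rw [← norm_le_zero_iff]
    refine ge_of_tendsto' hproj' fun j => ?_
    rw [← LinearIsometryEquiv.inner_map_map (S.dilateEquiv ((j + M : ℕ) : ℤ)) f g,
      ← Submodule.starProjection_eq_self_iff.mpr (hf ((j + M : ℕ) : ℤ)),
      Submodule.inner_starProjection_left_eq_right,
      ← LinearIsometryEquiv.norm_map (S.dilateEquiv ((j + M : ℕ) : ℤ)) f]
    exact norm_inner_le_norm _ _
  have hlim : Tendsto (fun N => inner ℂ f (truncLp f N)) atTop (𝓝 (inner ℂ f f : ℂ)) :=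
    (tendsto_const_nhds (x := f)).inner (tendsto_truncLp f)
  simp_rw [key] at hlim
  exact inner_self_eq_zero.mp (tendsto_nhds_unique hlim tendsto_const_nhds)

end Refinement

section MultiresolutionAnalysis

variable {K : Type*} [NontriviallyNormedField K] [IsUltrametricDist K] [ProperSpace K]
  [MeasurableSpace K] [BorelSpace K] {μ : Measure K} [μ.IsAddHaarMeasure]
  {p : ℕ} [hp : Fact p.Prime] [CharP K p] {c : ℕ} [NeZero c] {ϖ : K} {ε : Fin c → K}
  {χ : AddChar K Circle} {φ : Lp ℂ 2 μ} {V : Submodule ℂ (Lp ℂ 2 μ)}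

/-- If `|φ̂(ϖ ^ j ξ)| → 1` a.e., then `⋃ D^j V` contains in its closure every function whose
Fourier transform is the indicator of a bounded set. -/
theorem Admissible.mem_closure_iUnion_dilate (S : Admissible μ p ϖ ε χ)
    (he : IsParsevalFrame (translates μ p ϖ ε φ) V) [V.HasOrthogonalProjection]
    (hlim : ∀ᵐ ξ ∂μ, Tendsto (fun j : ℕ => ‖S.fourierIsometry φ (ϖ ^ j * ξ)‖) atTop (𝓝 1))
    {A : Set K} (hA : MeasurableSet A) {m : ℕ} (hAm : A ⊆ fracIdeal ϖ (-(m : ℤ))) {f : Lp ℂ 2 μ}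
    (hf : S.fourierIsometry f =ᵐ[μ] A.indicator fun _ => 1) (hfn : ‖f‖ ^ 2 = μ.real A) :
    f ∈ closure (⋃ j : ℤ, S.dilateEquiv j '' (V : Set (Lp ℂ 2 μ))) := by
  have hsub (j : ℕ) : A ⊆ fracIdeal ϖ (-((j + m : ℕ) : ℤ)) :=
    hAm.trans (fracIdeal_antitone S.prime (by push_cast; omega))
  have hAfin : IsFiniteMeasure (μ.restrict A) :=
    ⟨by simpa using (measure_ne_top_of_subset_fracIdeal hAm).lt_top⟩
  have h1 : Tendsto (fun j : ℕ =>
      ∫ ξ in A, ‖S.fourierIsometry φ (ϖ ^ ((j + m : ℕ) : ℤ) * ξ)‖ ^ 2 ∂μ) atTop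
      (𝓝 (∫ _ in A, (1 : ℝ) ∂μ)) := by
    refine tendsto_integral_of_dominated_convergence (fun _ => 1)
      (fun j => (S.integrable_norm_sq_dilate _ _).restrict.aestronglyMeasurable)
      (integrable_const 1) (fun j => ?_) ?_
    · refine (ae_restrict_iff' hA).mpr ?_
      filter_upwards [S.norm_fourier_le_one he ((j + m : ℕ) : ℤ)] with ξ h hξ
      rw [Real.norm_of_nonneg (by positivity)]
      exact h (hsub j hξ)
    · refine ae_restrict_of_ae ?_
      filter_upwards [hlim] with ξ h
      have h' := (h.comp (tendsto_add_atTop_nat m)).pow 2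
      rw [one_pow] at h'
      simp_rw [zpow_natCast]
      exact h'
  simp_rw [← S.norm_sq_starProjection_dilate he hA _ (hsub _) hf] at h1
  rw [setIntegral_const, smul_eq_mul, mul_one, ← hfn] at h1
  have h2 (j : ℕ) : ‖f - S.dilateEquiv ((j + m : ℕ) : ℤ)
      (V.starProjection (S.dilateEquiv (-((j + m : ℕ) : ℤ)) f))‖ ^ 2 =
      ‖f‖ ^ 2 - ‖V.starProjection (S.dilateEquiv (-((j + m : ℕ) : ℤ)) f)‖ ^ 2 := by
    set g := S.dilateEquiv (-((j + m : ℕ) : ℤ)) f with hg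
    have hfg : f = S.dilateEquiv ((j + m : ℕ) : ℤ) g := by
      rw [hg, S.dilateEquiv_dilateEquiv, add_neg_cancel, S.dilateEquiv_zero]
    rw [hfg, ← map_sub, LinearIsometryEquiv.norm_map, LinearIsometryEquiv.norm_map,
      ← Submodule.starProjection_orthogonal_val]
    linarith [Submodule.norm_sq_eq_add_norm_sq_starProjection g V]
  have h3 : Tendsto (fun j : ℕ => ‖f - S.dilateEquiv ((j + m : ℕ) : ℤ)
      (V.starProjection (S.dilateEquiv (-((j + m : ℕ) : ℤ)) f))‖ ^ 2) atTop (𝓝 0) := by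
    simp_rw [h2]
    have h' := (tendsto_const_nhds (x := ‖f‖ ^ 2)).sub h1
    rwa [sub_self] at h'
  refine mem_closure_of_tendsto (f := fun j : ℕ => S.dilateEquiv ((j + m : ℕ) : ℤ)
      (V.starProjection (S.dilateEquiv (-((j + m : ℕ) : ℤ)) f))) (b := atTop) ?_
    (Eventually.of_forall fun j => Set.mem_iUnion.mpr
      ⟨_, _, V.starProjection_apply_mem _, rfl⟩)
  rw [tendsto_iff_norm_sub_tendsto_zero]
  have h4 := h3.sqrt
  simp only [Real.sqrt_sq (norm_nonneg _), Real.sqrt_zero] at h4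
  simpa only [norm_sub_rev f] using h4

theorem Admissible.closure_iUnion_dilate (S : Admissible μ p ϖ ε χ)
    (he : IsParsevalFrame (translates μ p ϖ ε φ) V) [V.HasOrthogonalProjection]
    (hV : ∀ f ∈ V, S.dilateEquiv (-1) f ∈ V)
    (hlim : ∀ᵐ ξ ∂μ, Tendsto (fun j : ℕ => ‖S.fourierIsometry φ (ϖ ^ j * ξ)‖) atTop (𝓝 1)) :
    closure (⋃ j : ℤ, S.dilateEquiv j '' (V : Set (Lp ℂ 2 μ))) = Set.univ := by
  set W : ℤ → Submodule ℂ (Lp ℂ 2 μ) := fun j =>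
    V.map (S.dilateEquiv j).toLinearEquiv.toLinearMap with hW
  have hmono : Monotone W := by
    rintro i j hij _ ⟨v, hv, rfl⟩
    refine ⟨S.dilateEquiv (-((j - i).toNat : ℤ)) v, S.dilate_mem_of_nonpos hV _ hv, ?_⟩
    change S.dilateEquiv j _ = S.dilateEquiv i v
    rw [S.dilateEquiv_dilateEquiv, Int.toNat_of_nonneg (by omega)]
    congr 2
    ring
  have hcoe : ((⨆ j, W j : Submodule ℂ (Lp ℂ 2 μ)) : Set (Lp ℂ 2 μ)) =
      ⋃ j : ℤ, S.dilateEquiv j '' (V : Set (Lp ℂ 2 μ)) :=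
    Submodule.coe_iSup_of_directed W hmono.directed_le
  rw [← hcoe, ← Submodule.topologicalClosure_coe]
  suffices h : (⨆ j, W j).topologicalClosure = ⊤ by rw [h]; rfl
  rw [Submodule.topologicalClosure_eq_top_iff, Submodule.eq_bot_iff]
  intro g hg
  rw [← Submodule.orthogonal_closure] at hg
  refine S.fourierIsometry.injective ?_
  rw [map_zero, Lp.eq_zero_iff_ae_eq_zero]
  refine ae_eq_zero_of_forall_setIntegral_closedBall S.prime
    ((Lp.memLp _).locallyIntegrable one_le_two) fun a n => ?_
  obtain ⟨m, hm⟩ := exists_closedBall_subset_fracIdeal S.prime (‖ϖ‖ ^ n + dist a 0)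
  have hA : Metric.closedBall a (‖ϖ‖ ^ n) ⊆ fracIdeal ϖ (-(m : ℤ)) :=
    (Metric.closedBall_subset_closedBall' le_rfl).trans hm
  obtain ⟨f, hf, hfn⟩ := S.exists_fourier_eq_indicator measurableSet_closedBall
    (measure_ne_top_of_subset_fracIdeal hA)
  have hmem := S.mem_closure_iUnion_dilate he hlim measurableSet_closedBall hA hf hfn
  rw [← hcoe, ← Submodule.topologicalClosure_coe] at hmem
  have h := hg f hmem
  rw [← S.fourierIsometry.inner_map_map, L2.inner_def] at h
  rw [← h, ← integral_indicator measurableSet_closedBall]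
  refine integral_congr_ae ?_
  filter_upwards [hf] with x hx
  rw [hx]
  by_cases hxa : x ∈ Metric.closedBall a (‖ϖ‖ ^ n)
  · simp [Set.indicator_of_mem hxa]
  · simp [Set.indicator_of_notMem hxa]

theorem map_closure_span_le {H : Type*} [NormedAddCommGroup H] [InnerProductSpace ℂ H]
    {e : ℕ → H} {A : H →L[ℂ] H} {W : Submodule ℂ H} (hW : IsClosed (W : Set H))
    (h : ∀ k, A (e k) ∈ W) :
    ∀ f ∈ (Submodule.span ℂ (Set.range e)).topologicalClosure, A f ∈ W := by
  have hle : (Submodule.span ℂ (Set.range e)).topologicalClosure ≤ W.comap A.toLinearMap := by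
    refine Submodule.topologicalClosure_minimal _ (Submodule.span_le.mpr ?_)
      (hW.preimage A.continuous)
    rintro _ ⟨k, rfl⟩
    exact h k
  exact fun f hf => hle hf

theorem translates_mem_closure_span (φ : Lp ℂ 2 μ) (k : ℕ) : translates μ p ϖ ε φ k ∈
    (Submodule.span ℂ (Set.range (translates μ p ϖ ε φ))).topologicalClosure :=
  Submodule.le_topologicalClosure _ (Submodule.subset_span ⟨k, rfl⟩)

theorem translate_mem_closure_span (φ : Lp ℂ 2 μ) (l : ℕ) :
    ∀ f ∈ (Submodule.span ℂ (Set.range (translates μ p ϖ ε φ))).topologicalClosure,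
      translate μ (u p ϖ ε l) f ∈
        (Submodule.span ℂ (Set.range (translates μ p ϖ ε φ))).topologicalClosure := by
  refine map_closure_span_le (A := (translateIsometry μ (u p ϖ ε l)).toContinuousLinearMap)
    (Submodule.isClosed_topologicalClosure _) fun k => ?_
  change translate μ _ (translate μ _ φ) ∈ _
  obtain ⟨m, hm⟩ := exists_u_add (p := p) (ϖ := ϖ) (ε := ε) l k
  rw [translate_translate, ← hm]
  exact translates_mem_closure_span φ m

theorem Admissible.dilate_mem_closure_span (S : Admissible μ p ϖ ε χ) (φ : Lp ℂ 2 μ)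
    (h : S.dilateEquiv (-1) φ ∈
      (Submodule.span ℂ (Set.range (translates μ p ϖ ε φ))).topologicalClosure) :
    ∀ f ∈ (Submodule.span ℂ (Set.range (translates μ p ϖ ε φ))).topologicalClosure,
      S.dilateEquiv (-1) f ∈
        (Submodule.span ℂ (Set.range (translates μ p ϖ ε φ))).topologicalClosure := by
  refine map_closure_span_le
    (A := ((S.dilateEquiv (-1)).toContinuousLinearEquiv : Lp ℂ 2 μ →L[ℂ] Lp ℂ 2 μ))
    (Submodule.isClosed_topologicalClosure _) fun k => ?_
  change S.dilateEquiv (-1) (translate μ _ φ) ∈ _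
  rw [S.dilateEquiv_translate, zpow_neg_one, inv_mul_u]
  exact translate_mem_closure_span φ _ _ h

/-- The closed span of the translates of `φ` is the core space of a Parseval multiresolution
analysis, under the conditions of the characterization theorem. -/
theorem Admissible.isParsevalMRA (S : Admissible μ p ϖ ε χ) (φ : Lp ℂ 2 μ)
    (he : IsParsevalFrame (translates μ p ϖ ε φ)
      (Submodule.span ℂ (Set.range (translates μ p ϖ ε φ))).topologicalClosure)
    (hlim : ∀ᵐ ξ ∂μ, Tendsto (fun j : ℕ => ‖S.fourierIsometry φ (ϖ ^ j * ξ)‖) atTop (𝓝 1))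
    {m₀ : K → ℂ} (hper : IntegralPeriodic p ϖ ε m₀) (hL : MemLp m₀ 2 (integersMeasure μ))
    (hm : ∀ᵐ ξ ∂μ, S.fourierIsometry φ ξ = m₀ (ϖ * ξ) * S.fourierIsometry φ (ϖ * ξ)) :
    IsParsevalMRA μ p S.prime.ne_zero ε
      (Submodule.span ℂ (Set.range (translates μ p ϖ ε φ))).topologicalClosure φ := by
  have hclosed := Submodule.isClosed_topologicalClosure
    (Submodule.span ℂ (Set.range (translates μ p ϖ ε φ)))
  set V := (Submodule.span ℂ (Set.range (translates μ p ϖ ε φ))).topologicalClosure with hVdef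
  have hcomplete : CompleteSpace V := hclosed.completeSpace_coe
  have hV : ∀ f ∈ V, S.dilateEquiv (-1) f ∈ V :=
    S.dilate_mem_closure_span φ (S.dilate_mem_of_filter he hper hL hm)
  refine ⟨hclosed, fun k => ?_, fun f hf => ?_, ?_, ?_, ?_, he⟩
  · refine Set.Subset.antisymm ?_ fun f hf => ?_
    · rintro _ ⟨f, hf, rfl⟩
      exact translate_mem_closure_span φ k f hf
    · obtain ⟨l, hl⟩ := exists_u_neg (p := p) (ϖ := ϖ) (ε := ε) k
      refine ⟨_, translate_mem_closure_span φ l f hf, ?_⟩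
      rw [translate_translate, hl, add_neg_cancel, translate_zero]
  · refine ⟨_, hV f hf, ?_⟩
    change S.dilateEquiv 1 _ = f
    rw [S.dilateEquiv_dilateEquiv, add_neg_cancel, S.dilateEquiv_zero]
  · refine Set.Subset.antisymm (fun f hf => ?_) ?_
    · refine S.eq_zero_of_forall_mem_dilate he fun j => ?_
      obtain ⟨v, hv, rfl⟩ := Set.mem_iInter.mp hf (-j)
      change S.dilateEquiv j (S.dilateEquiv (-j) v) ∈ V
      rwa [S.dilateEquiv_dilateEquiv, add_neg_cancel, S.dilateEquiv_zero]
    · rintro _ rfl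
      exact Set.mem_iInter.mpr fun j => ⟨0, V.zero_mem, map_zero (S.dilateEquiv j)⟩
  · exact S.closure_iUnion_dilate he hV hlim
  · have := translates_mem_closure_span (p := p) (ϖ := ϖ) (ε := ε) φ 0
    rwa [translates, u_zero, translate_zero] at this

end MultiresolutionAnalysis

end LocalFieldMRA

theorem proposition4p3
    {K : Type*} [NontriviallyNormedField K] [IsUltrametricDist K] [LocallyCompactSpace K]
    [MeasurableSpace K] [BorelSpace K]
    (p : ℕ) [Fact p.Prime] [CharP K p]
    (μ : MeasureTheory.Measure K) [μ.IsAddHaarMeasure]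
    (hμ : μ (Metric.closedBall (0 : K) 1) = 1)
    (ϖ : K) (hϖ : LocalFieldMRA.IsPrimeElement ϖ)
    (c : ℕ) [NeZero c] (ε : Fin c → K) (hε : LocalFieldMRA.IsResidueBasis p ε)
    (χ : AddChar K Circle) (hχ : LocalFieldMRA.IsBasicCharacter ϖ ε χ)
    (φ : MeasureTheory.Lp ℂ 2 μ) :
    LocalFieldMRA.IsParsevalScalingFunction μ p hϖ.ne_zero ε φ ↔
      (LocalFieldMRA.IsParsevalFrame (LocalFieldMRA.translates μ p ϖ ε φ)
          (Submodule.span ℂ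
            (Set.range (LocalFieldMRA.translates μ p ϖ ε φ))).topologicalClosure) ∧
      (∀ᵐ ξ ∂μ, Filter.Tendsto (fun j : ℕ => ‖LocalFieldMRA.fourier μ χ φ (ϖ ^ j * ξ)‖)
          Filter.atTop (nhds 1)) ∧
      (∃ m₀ : K → ℂ, LocalFieldMRA.IntegralPeriodic p ϖ ε m₀ ∧
          MeasureTheory.MemLp m₀ 2 (μ.restrict (Metric.closedBall (0 : K) 1)) ∧
          ∀ᵐ ξ ∂μ, LocalFieldMRA.fourier μ χ φ ξ =
            m₀ (ϖ * ξ) * LocalFieldMRA.fourier μ χ φ (ϖ * ξ)) := by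
  have : ProperSpace K := ProperSpace.of_locallyCompactSpace K
  have S : LocalFieldMRA.Admissible μ p ϖ ε χ := ⟨hμ, hϖ, hε, hχ⟩
  constructor
  · rintro ⟨V, hMRA⟩
    have hcomplete : CompleteSpace V := hMRA.isClosed.completeSpace_coe
    have he := hMRA.scaling_frame
    have hV : ∀ f ∈ V, S.dilateEquiv (-1) f ∈ V := by
      intro f hf
      obtain ⟨v, hv, hvf⟩ := hMRA.subset_dilate hf
      change S.dilateEquiv 1 v = f at hvf
      rwa [← hvf, S.dilateEquiv_dilateEquiv, neg_add_cancel, S.dilateEquiv_zero]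
    have hle : (Submodule.span ℂ
        (Set.range (LocalFieldMRA.translates μ p ϖ ε φ))).topologicalClosure ≤ V :=
      Submodule.topologicalClosure_minimal _
        (Submodule.span_le.mpr (Set.range_subset_iff.mpr he.1)) hMRA.isClosed
    exact ⟨⟨LocalFieldMRA.translates_mem_closure_span φ, fun f hf => he.2 f (hle hf)⟩,
      S.tendsto_norm_fourier he hV hMRA.closure_iUnion_dilate,
      S.exists_filter he (hV φ hMRA.scaling_mem)⟩
  · rintro ⟨he, hlim, m₀, hper, hL, hm⟩
    exact ⟨_, S.isParsevalMRA φ he hlim hper hL hm⟩
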